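/- Let $K$ be a field of characteristic $0$ (for instance $\mathbb{C}$), let $A=\{a_1,a_2,\dots\}$ and $B=\{b_1,b_2,\dots\}$ be two countably infinite alphabets of commuting formal variables, and for a partition $\alpha$ with $\ell(\alpha)$ parts put $p_\alpha(A)=\prod_{i=1}^{\ell(\alpha)}\sum_{j\ge 1}a_j^{\alpha_i}$ and $p_\alpha(B)=\prod_{i=1}^{\ell(\alpha)}\sum_{j\ge 1}b_j^{\alpha_i}$. For $\alpha,\beta\vdash d$ let $C_\alpha,C_\beta$ be the conjugacy classes in the symmetric group $S(d)$ of permutations of cycle type $\alpha,\beta$, and let $\vec W^r(\alpha,\beta)$ be the number of monotone $r$-step walks from $C_\alpha$ to $C_\beta$, i.e. of tuples $(\rho,(s_1\,t_1),\dots,(s_r\,t_r))$ with $\rho\in C_\alpha$, transpositions with $s_i<t_i$ and $t_1\le\dots\le t_r$, and $\rho\,(s_1\,t_1)\cdots(s_r\,t_r)\in C_\beta$. For $d\ge1$ and $g\ge 0$, the connected monotone double Hurwitz number $\vec H_g(\alpha,\beta)$ is the number of such tuples with $r=2g-2+\ell(\alpha)+\ell(\beta)$ for which $\rho,(s_1\,t_1),\dots,(s_r\,t_r)$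 generate a transitive subgroup of $S(d)$. The connected monotone single and simple Hurwitz numbers are $\vec H_g(\alpha)=\vec H_g(\alpha,1^d)$ and $\vec H_g^d=\vec H_g(1^d)$. The stable partition functions $I^{(m)}=1+\sum_{d\ge1}\frac{z^d}{d!}I^{(m)d}$, $m=0,1,2$, are the formal power series in $z$ whose coefficients are the following formal Laurent series in $\hbar$ (over the ring of formal power series over $K$ in the variables $a_j,b_j$): $$I^{(0)d}=\hbar^{-2d}\sum_{r\ge0}(-\hbar)^r\,\vec W^r(1^d,1^d),\qquad I^{(1)d}=\hbar^{-d}\sum_{\alpha\vdash d}p_\alpha(A)\sum_{r\ge0}(-\hbar)^r\,\vec W^r(\alpha,1^d),$$ $$I^{(2)d}=\sum_{\alpha,\beta\vdash d}p_\alpha(A)p_\beta(B)\sum_{r\ge0}(-\hbar)^r\,\vec W^r(\alpha,\beta).$$ Theorem. For each $m\in\{0,1,2\}$, $$\log I^{(m)}=\sum_{g=0}^\infty\hbar^{2g-2}F^{(m)}_g,$$ where $$F_g^{(0)}=\sum_{d\ge1}\frac{z^d}{d!}\vec H_g^d,\qquad F_g^{(1)}=\sum_{d\ge1}\frac{z^d}{d!}\sum_{\alpha\vdash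 d}\hbar^{\ell(\alpha)}p_\alpha(A)(-1)^{\ell(\alpha)+d}\,\vec H_g(\alpha),$$ $$F_g^{(2)}=\sum_{d\ge1}\frac{z^d}{d!}\sum_{\alpha,\beta\vdash d}\hbar^{\ell(\alpha)+\ell(\beta)}p_\alpha(A)p_\beta(B)(-1)^{\ell(\alpha)+\ell(\beta)}\,\vec H_g(\alpha,\beta)$$ are the genus $g$ generating functions of the connected monotone simple, single and double Hurwitz numbers. Here $\log I=\sum_{n\ge1}\frac{(-1)^{n+1}}{n}(I-1)^n$ in the ring of power series in $z$, and the sum over $g$ is a formal sum: for every $d$, the coefficients of $z^d$ in the summands have $\hbar$-orders bounded below, each power of $\hbar$ occurs in only finitely many of them, and their sum is the coefficient of $z^d$ in $\log I^{(m)}$. -/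

import Mathlib

namespace MonotoneHurwitz

/-- The cycle type of a permutation of `{1, …, d}`, as a multiset of natural numbers
(fixed points contribute parts equal to `1`). -/
def cycles {d : ℕ} (σ : Equiv.Perm (Fin d)) : Multiset ℕ := σ.partition.parts

/-- The number of rows `ℓ(α)` of a partition (Young diagram) `α ⊢ d`. -/
def len {d : ℕ} (α : d.Partition) : ℕ := Multiset.card α.parts

/-- The partition `1^d = (1, 1, …, 1)` of `d`. -/
def ones (d : ℕ) : d.Partition where
  parts := Multiset.replicate d 1
  parts_pos := by
    intro i hi
    rw [Multiset.eq_of_mem_replicate hi]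
    exact Nat.one_pos
  parts_sum := by simp

/-- The transposition that labels an edge of the Cayley graph of the symmetric group. -/
def edge {d r : ℕ} (e : Fin r → Fin d × Fin d) (i : Fin r) : Equiv.Perm (Fin d) :=
  Equiv.swap (e i).1 (e i).2

/-- `e` is a sequence of transpositions `(s_i t_i)` with `s_i < t_i` whose labels `t_i`
(the larger of the two numbers interchanged) are weakly increasing. -/
def IsMonotoneSteps {d r : ℕ} (e : Fin r → Fin d × Fin d) : Prop :=
  (∀ i, (e i).1 < (e i).2) ∧ ∀ i j, i ≤ j → (e i).2 ≤ (e j).2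

/-- The endpoint of the walk that starts at `ρ` and traverses the edges `e` in order. -/
def endpoint {d r : ℕ} (ρ : Equiv.Perm (Fin d)) (e : Fin r → Fin d × Fin d) :
    Equiv.Perm (Fin d) :=
  ρ * (List.ofFn (edge e)).prod

/-- The monotone `r`-step walks on the Cayley graph of the symmetric group of degree `d`, as
generated by all transpositions, from the conjugacy class `C_α` to the conjugacy class `C_β`.
A walk is given by its starting point and the sequence of its edges. -/
def monotoneWalks {d : ℕ} (r : ℕ) (α β : d.Partition) :
    Set (Equiv.Perm (Fin d) × (Fin r → Fin d × Fin d)) :=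
  {w | cycles w.1 = α.parts ∧ IsMonotoneSteps w.2 ∧ cycles (endpoint w.1 w.2) = β.parts}

/-- The walk starting at `ρ` with edges `e` is connected: the group generated by its starting
point and its steps (the monodromy group of the corresponding branched cover) is transitive. -/
def IsConnectedWalk {d r : ℕ} (ρ : Equiv.Perm (Fin d)) (e : Fin r → Fin d × Fin d) : Prop :=
  ∀ x y : Fin d, ∃ σ ∈ Subgroup.closure (insert ρ (Set.range (edge e))), σ x = y

/-- The number of monotone `r`-step walks from `C_α` to `C_β`. -/
noncomputable def walkCount {d : ℕ} (r : ℕ) (α β : d.Partition) : ℕ :=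
  (monotoneWalks r α β).ncard

/-- The number of connected monotone `r`-step walks from `C_α` to `C_β`. -/
noncomputable def connectedWalkCount {d : ℕ} (r : ℕ) (α β : d.Partition) : ℕ :=
  {w ∈ monotoneWalks r α β | IsConnectedWalk w.1 w.2}.ncard

/-- The connected monotone double Hurwitz number of genus `g`: the number of connected monotone
walks from `C_α` to `C_β` whose length is `2g - 2 + ℓ(α) + ℓ(β)`. For `d ≥ 1` one has
`ℓ(α) + ℓ(β) ≥ 2`, so that the subtraction is not truncated. -/
noncomputable def doubleHurwitz {d : ℕ} (g : ℕ) (α β : d.Partition) : ℕ :=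
  connectedWalkCount (2 * g + len α + len β - 2) α β

/-- The connected monotone single Hurwitz number of genus `g`. -/
noncomputable def singleHurwitz {d : ℕ} (g : ℕ) (α : d.Partition) : ℕ :=
  doubleHurwitz g α (ones d)

/-- The connected monotone simple Hurwitz number of degree `d` and genus `g`. -/
noncomputable def simpleHurwitz (d g : ℕ) : ℕ :=
  singleHurwitz g (ones d)

/-- Formal power series in two countably infinite alphabets: `a_j` is the variable `Sum.inl j`
and `b_j` is the variable `Sum.inr j`. -/
abbrev Coef (K : Type*) := MvPowerSeries (ℕ ⊕ ℕ) K

/-- The power sum `∑_j x_j ^ k` (for `k ≥ 1`) over the alphabet `x`, summed coefficientwise. -/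
noncomputable def powerSum (K : Type*) [Field K] (x : ℕ → ℕ ⊕ ℕ) (k : ℕ) : Coef K :=
  fun n => ∑ᶠ j : ℕ, MvPowerSeries.coeff n ((MvPowerSeries.X (x j) : Coef K) ^ k)

/-- The Newton power sum symmetric function `p_α(A) = ∏_i ∑_j a_j ^ α_i`. -/
noncomputable def newtonA (K : Type*) [Field K] {d : ℕ} (α : d.Partition) : Coef K :=
  (α.parts.map (powerSum K Sum.inl)).prod

/-- The Newton power sum symmetric function `p_β(B) = ∏_i ∑_j b_j ^ β_i`. -/
noncomputable def newtonB (K : Type*) [Field K] {d : ℕ} (β : d.Partition) : Coef K :=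
  (β.parts.map (powerSum K Sum.inr)).prod

/-- The monomial `c ħ^n`, for an integer `n`, among the formal Laurent series in `ħ`. -/
noncomputable def hbar {K : Type*} [Field K] (n : ℤ) (c : Coef K) : LaurentSeries (Coef K) :=
  HahnSeries.single n c

/-- The series `∑_{r ≥ 0} (-ħ)^r W^r(α, β)`. -/
noncomputable def walkSeries (K : Type*) [Field K] {d : ℕ} (α β : d.Partition) :
    LaurentSeries (Coef K) :=
  HahnSeries.ofPowerSeries ℤ (Coef K)
    (PowerSeries.mk fun r => (-1) ^ r * (walkCount r α β : Coef K))

/-- The power series `c + ∑_{d ≥ 1} (z^d / d!) u_d` in `z`. -/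
noncomputable def couplingSeries {K : Type*} [Field K] (c : LaurentSeries (Coef K))
    (u : ℕ → LaurentSeries (Coef K)) : PowerSeries (LaurentSeries (Coef K)) :=
  PowerSeries.mk fun d => if d = 0 then c else (d.factorial : K)⁻¹ • u d

/-- The stable partition function `I^(0)`. -/
noncomputable def partitionFunction0 (K : Type*) [Field K] :
    PowerSeries (LaurentSeries (Coef K)) :=
  couplingSeries 1 fun d => hbar (-(2 * d)) 1 * walkSeries K (ones d) (ones d)

/-- The stable partition function `I^(1)`. -/
noncomputable def partitionFunction1 (K : Type*) [Field K] :
    PowerSeries (LaurentSeries (Coef K)) :=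
  couplingSeries 1 fun d =>
    ∑ α : d.Partition, hbar (-d) (newtonA K α) * walkSeries K α (ones d)

/-- The stable partition function `I^(2)`. -/
noncomputable def partitionFunction2 (K : Type*) [Field K] :
    PowerSeries (LaurentSeries (Coef K)) :=
  couplingSeries 1 fun d =>
    ∑ α : d.Partition, ∑ β : d.Partition,
      hbar 0 (newtonA K α * newtonB K β) * walkSeries K α β

/-- The generating function `F_g^(0)` of connected monotone simple Hurwitz numbers. -/
noncomputable def freeEnergy0 (K : Type*) [Field K] (g : ℕ) :
    PowerSeries (LaurentSeries (Coef K)) :=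
  couplingSeries 0 fun d => hbar 0 (simpleHurwitz d g : Coef K)

/-- The generating function `F_g^(1)` of connected monotone single Hurwitz numbers. -/
noncomputable def freeEnergy1 (K : Type*) [Field K] (g : ℕ) :
    PowerSeries (LaurentSeries (Coef K)) :=
  couplingSeries 0 fun d =>
    ∑ α : d.Partition,
      hbar (len α) (newtonA K α * (-1) ^ (len α + d) * (singleHurwitz g α : Coef K))

/-- The generating function `F_g^(2)` of connected monotone double Hurwitz numbers. -/
noncomputable def freeEnergy2 (K : Type*) [Field K] (g : ℕ) :
    PowerSeries (LaurentSeries (Coef K)) :=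
  couplingSeries 0 fun d =>
    ∑ α : d.Partition, ∑ β : d.Partition,
      hbar (len α + len β) (newtonA K α * newtonB K β * (-1) ^ (len α + len β) *
        (doubleHurwitz g α β : Coef K))

/-- `S = ∑_{g ≥ 0} ħ^(2g-2) F_g` as formal series: for every power `z^d`, the coefficients of
`z^d` in the summands form a summable family of Laurent series in `ħ`
(their orders are bounded below and every power of `ħ` occurs in only finitely many of them),
and the sum of this family is the coefficient of `z^d` in `S`. -/
def HasTopologicalExpansion {K : Type*} [Field K] (S : PowerSeries (LaurentSeries (Coef K)))
    (F : ℕ → PowerSeries (LaurentSeries (Coef K))) : Prop :=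
  ∀ d : ℕ, ∃ s : HahnSeries.SummableFamily ℤ (Coef K) ℕ,
    (∀ g : ℕ, s g = 
      PowerSeries.coeff d (PowerSeries.C (hbar (2 * (g : ℤ) - 2) (1 : Coef K)) * F g)) ∧
      s.hsum = PowerSeries.coeff d S

end MonotoneHurwitz

/-! The theorem combines the exponential formula with the Riemann–Hurwitz relation. Cut a monotone
walk along the orbit of one point under its monodromy group: a connected walk on the orbit and an
arbitrary walk on the complement remain. Steps from different pieces commute, and no larger entry
`t` occurs in both pieces, so the pieces have exactly one monotone interleaving. Choosing the orbit
therefore costs a binomial coefficient, while step numbers merely add: the series is exponential in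
`z` and ordinary in `ħ` (`total_succ`). After division by `d!` this recursion is the equation `I' =
I L'`, so the connected series `L` is `log I` (`logOf_mk_eq`).

A connected walk of `r` steps from `α` to `β` has `r = 2g - 2 + ℓ(α) + ℓ(β)` with `g ≥ 0` an integer
(`exists_genus`). This comes from comparing cycles with orbits as steps are appended, both counted
as dimensions of spaces of invariant functions. It sorts the connected series by genus and turns
`(-1)^r` into `(-1)^(ℓ(α)+ℓ(β))`.

The three cases are instances of `hasTopologicalExpansion_logOf`, where the cycles of the start and
of the endpoint carry weights `f` and `g` and degree `d` carries `ħ^(-cd)`. The weights are power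
sums or the indicator of parts equal to `1`, and `c = 2 - m`. -/

namespace MonotoneHurwitz

open Equiv

/-! ### Merging sorted lists and splitting them again. -/

section Lists

variable {α : Type*}

theorem filter_merge_left (le : α → α → Bool) (p : α → Bool) (A B : List α)
    (hA : ∀ a ∈ A, p a = true) (hB : ∀ b ∈ B, p b = false) :
    (A.merge B le).filter p = A := by
  fun_induction List.merge A B le with
  | case1 => simpa using hB
  | case2 => simpa using hA
  | case3 x xs y ys h ih =>
    rw [List.filter_cons_of_pos (hA x (by simp)), ih (fun a ha => hA a (by simp [ha])) hB]
  | case4 x xs y ys h ih =>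
    rw [List.filter_cons_of_neg (by simp [hB y (by simp)]),
      ih hA (fun b hb => hB b (by simp [hb]))]

theorem filter_merge_right (le : α → α → Bool) (p : α → Bool) (A B : List α)
    (hA : ∀ a ∈ A, p a = true) (hB : ∀ b ∈ B, p b = false) :
    (A.merge B le).filter (fun a => !p a) = B := by
  fun_induction List.merge A B le with
  | case1 => simpa using hB
  | case2 => simpa using hA
  | case3 x xs y ys h ih =>
    rw [List.filter_cons_of_neg (by simp [hA x (by simp)]),
      ih (fun a ha => hA a (by simp [ha])) hB]
  | case4 x xs y ys h ih =>
    rw [List.filter_cons_of_pos (by simp [hB y (by simp)]),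
      ih hA (fun b hb => hB b (by simp [hb]))]

/-- Merging only moves entries of `B` leftwards past entries of `A`, with which they commute. -/
theorem prod_map_merge {G : Type*} [Monoid G] (f : α → G) (le : α → α → Bool) (A B : List α)
    (h : ∀ a ∈ A, ∀ b ∈ B, Commute (f a) (f b)) :
    ((A.merge B le).map f).prod = (A.map f).prod * (B.map f).prod := by
  fun_induction List.merge A B le with
  | case1 => simp
  | case2 => simp
  | case3 x xs y ys hle ih =>
    simp [ih (fun a ha b hb => h a (by simp [ha]) b hb), mul_assoc]
  | case4 x xs y ys hle ih =>
    have hc : Commute ((List.map f (x :: xs)).prod) (f y) :=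
      Commute.list_prod_left _ _ (by
        intro g hg
        obtain ⟨a, ha, rfl⟩ := List.mem_map.1 hg
        exact h a ha y (by simp))
    simp only [List.map_cons, List.prod_cons] at hc ⊢
    rw [ih (fun a ha b hb => h a ha b (by simp [hb])), List.map_cons, List.prod_cons,
      ← mul_assoc, ← hc.eq, mul_assoc]

/-- Two lists sorted by a key agree when their restrictions to a set and to its complement agree,
provided that membership in the set depends on the key only. -/
theorem sorted_ext_filter {β : Type*} [LinearOrder β] (key : α → β) (p : α → Bool)
    (hp : ∀ a b, key a = key b → p a = p b) :
    ∀ {L L' : List α}, L.Pairwise (fun a b => key a ≤ key b) →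
      L'.Pairwise (fun a b => key a ≤ key b) → L.filter p = L'.filter p →
      L.filter (fun a => !p a) = L'.filter (fun a => !p a) → L = L' := by
  intro L
  induction L with
  | nil =>
    intro L' _ _ h1 h2
    cases L' with
    | nil => rfl
    | cons b l =>
      cases hb : p b <;> simp [hb] at h1 h2
  | cons a l ih =>
    intro L' hL hL' h1 h2
    cases L' with
    | nil => cases ha : p a <;> simp [ha] at h1 h2
    | cons b l' =>
      rw [List.pairwise_cons] at hL hL'
      -- If the heads lay on different sides, equality of the filtered lists would place each head
      -- in the tail of the other list. Sortedness then makes the two keys equal, and `p` depends on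
      -- the key only.
      have key_eq : p a ≠ p b → False := by
        intro hne
        have hb : b ∈ l := by
          cases hpb : p b
          · have hpa : p a = true := by simpa [hpb] using hne
            simp only [List.filter_cons, hpa, hpb] at h2
            have : b ∈ l.filter (fun a => !p a) := by simp at h2; simp [h2]
            exact List.mem_of_mem_filter this
          · have hpa : p a = false := by simpa [hpb] using hne
            simp only [List.filter_cons, hpa, hpb] at h1
            have : b ∈ l.filter p := by simp at h1; simp [h1]
            exact List.mem_of_mem_filter this
        have ha : a ∈ l' := by
          cases hpb : p b
          · have hpa : p a = true := by simpa [hpb] using hne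
            simp only [List.filter_cons, hpa, hpb] at h1
            have : a ∈ l'.filter p := by simp at h1; simp [← h1]
            exact List.mem_of_mem_filter this
          · have hpa : p a = false := by simpa [hpb] using hne
            simp only [List.filter_cons, hpa, hpb] at h2
            have : a ∈ l'.filter (fun a => !p a) := by simp at h2; simp [← h2]
            exact List.mem_of_mem_filter this
        exact hne (hp _ _ (le_antisymm (hL.1 b hb) (hL'.1 a ha)))
      have hpab : p a = p b := by
        by_contra hne
        exact key_eq hne
      have hab : a = b ∧ l = l' := by
        cases hpb : p b
        · rw [hpb] at hpab
          simp [hpab, hpb] at h1 h2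
          exact ⟨h2.1, ih hL.2 hL'.2 h1 h2.2⟩
        · rw [hpb] at hpab
          simp [hpab, hpb] at h1 h2
          exact ⟨h1.1, ih hL.2 hL'.2 h1.2 h2⟩
      rw [hab.1, hab.2]

end Lists

/-! ### Cycle types under disjoint union and relabelling. -/

section CycleType

/-- `partition` is `cycleType` padded by a `1` for each fixed point. The first adds up because the
two extended permutations are disjoint, the padding because supports and ground sets add up. -/
theorem parts_sumCongr {α β : Type*} [Fintype α] [DecidableEq α] [Fintype β] [DecidableEq β]
    (σ : Perm α) (τ : Perm β) :
    (Perm.sumCongr σ τ).partition.parts = σ.partition.parts + τ.partition.parts := by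
  have key : (Perm.sumCongr σ τ).cycleType = σ.cycleType + τ.cycleType := by
    have h1 : Perm.sumCongr σ (1 : Perm β) = σ.extendDomain (Equiv.ofInjective _ Sum.inl_injective) := by
      ext x
      rcases x with x | x
      · have := Perm.extendDomain_apply_image σ (Equiv.ofInjective _ (Sum.inl_injective (α := α) (β := β))) x
        simpa using this.symm
      · rw [Perm.extendDomain_apply_not_subtype] <;> simp
    have h2 : Perm.sumCongr (1 : Perm α) τ = τ.extendDomain (Equiv.ofInjective _ Sum.inr_injective) := by
      ext x
      rcases x with x | x
      · rw [Perm.extendDomain_apply_not_subtype] <;> simp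
      · have := Perm.extendDomain_apply_image τ (Equiv.ofInjective _ (Sum.inr_injective (α := α) (β := β))) x
        simpa using this.symm
    have h3 : Perm.sumCongr σ τ = Perm.sumCongr σ 1 * Perm.sumCongr 1 τ := by
      rw [Perm.sumCongr_mul, mul_one, one_mul]
    have hd : Perm.Disjoint (Perm.sumCongr σ (1 : Perm β)) (Perm.sumCongr (1 : Perm α) τ) := by
      intro x
      rcases x with x | x <;> simp
    rw [h3, hd.cycleType_mul, h1, h2, Perm.cycleType_extendDomain, Perm.cycleType_extendDomain]
  have hs : (Perm.sumCongr σ τ).support.card = σ.support.card + τ.support.card := by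
    rw [← Perm.sum_cycleType, key, Multiset.sum_add, Perm.sum_cycleType, Perm.sum_cycleType]
  have e1 := σ.support.card_le_univ
  have e2 := τ.support.card_le_univ
  rw [Perm.parts_partition, Perm.parts_partition, Perm.parts_partition, key, hs, Fintype.card_sum,
    show Fintype.card α + Fintype.card β - (σ.support.card + τ.support.card) =
      (Fintype.card α - σ.support.card) + (Fintype.card β - τ.support.card) by omega,
    Multiset.replicate_add]
  abel

theorem parts_permCongr {α β : Type*} [Fintype α] [DecidableEq α] [Fintype β] [DecidableEq β]
    (e : α ≃ β) (σ : Perm α) : (e.permCongr σ).partition.parts = σ.partition.parts := by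
  have h1 : e.permCongr σ = σ.extendDomain (e.trans (Equiv.Set.univ β).symm) := by
    ext x
    obtain ⟨y, rfl⟩ := e.surjective x
    have := Perm.extendDomain_apply_image σ (e.trans (Equiv.Set.univ β).symm) y
    simpa using this.symm
  have key : (e.permCongr σ).cycleType = σ.cycleType := by
    rw [h1, Perm.cycleType_extendDomain]
  have hs : (e.permCongr σ).support.card = σ.support.card := by
    rw [← Perm.sum_cycleType, key, Perm.sum_cycleType]
  rw [Perm.parts_partition, Perm.parts_partition, key, hs, Fintype.card_congr e]

end CycleType

end MonotoneHurwitz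

namespace MonotoneHurwitz

open Equiv

/-! ### Walks as lists of steps, and their orbits. -/

/-- A starting permutation together with a list of pairs, the steps of a walk. -/
abbrev ListWalk (X : Type*) := Perm X × List (X × X)

namespace ListWalk

variable {X : Type*}

/-- The steps are pairs `(s, t)` with `s < t`, listed with weakly increasing `t`. -/
def IsMonotone [LinearOrder X] (L : List (X × X)) : Prop :=
  (∀ e ∈ L, e.1 < e.2) ∧ L.Pairwise (fun e e' => e.2 ≤ e'.2)

/-- The product of the transpositions in a list of steps. -/
def stepProd [DecidableEq X] (L : List (X × X)) : Perm X :=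
  (L.map fun e => swap e.1 e.2).prod

/-- The set `T` is a union of orbits of the monodromy group of the walk. -/
def Preserves (w : ListWalk X) (T : Set X) : Prop :=
  (∀ x, w.1 x ∈ T ↔ x ∈ T) ∧ ∀ e ∈ w.2, (e.1 ∈ T ↔ e.2 ∈ T)

/-- The monodromy group of the walk is transitive. -/
def IsConnected (w : ListWalk X) : Prop :=
  ∀ T : Set X, w.Preserves T → T.Nonempty → T = Set.univ

/-- The equivalences in `Preserves` are symmetric under complement, so connectedness need only be
tested on sets that contain a chosen point. -/
theorem Preserves.compl {w : ListWalk X} {T : Set X} (h : w.Preserves T) : w.Preserves Tᶜ :=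
  ⟨fun x => not_congr (h.1 x), fun e he => not_congr (h.2 e he)⟩

/-- The orbit of a point under the monodromy group of the walk. -/
def component (w : ListWalk X) (x : X) : Set X :=
  {y | ∀ T, w.Preserves T → x ∈ T → y ∈ T}

theorem preserves_component (w : ListWalk X) (x : X) : w.Preserves (w.component x) :=
  ⟨fun _ => forall_congr' fun _ => forall_congr' fun hT => forall_congr' fun _ => hT.1 _,
    fun e he => forall_congr' fun _ => forall_congr' fun hT => forall_congr' fun _ => hT.2 e he⟩

theorem mem_component_self (w : ListWalk X) (x : X) : x ∈ w.component x := fun _ _ h => h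

theorem component_subset {w : ListWalk X} {x : X} {T : Set X} (hT : w.Preserves T) (hx : x ∈ T) :
    w.component x ⊆ T := fun _ hy => hy T hT hx

variable [Fintype X] [LinearOrder X]

open Classical in
/-- All monotone walks with `r` steps. -/
noncomputable def monotone (X : Type*) [Fintype X] [LinearOrder X] (r : ℕ) :
    Finset (ListWalk X) :=
  ((Finset.univ : Finset (Perm X × (Fin r → X × X))).image
    fun w => (w.1, List.ofFn w.2)).filter fun w => IsMonotone w.2

theorem mem_monotone {r : ℕ} {w : ListWalk X} :
    w ∈ monotone X r ↔ w.2.length = r ∧ IsMonotone w.2 := by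
  classical
  simp only [monotone, Finset.mem_filter, Finset.mem_image, Finset.mem_univ, true_and]
  refine and_congr_left fun _ => ⟨?_, ?_⟩
  · rintro ⟨v, rfl⟩
    simp
  · rintro rfl
    exact ⟨(w.1, w.2.get), by simp⟩

open Classical in
/-- All connected monotone walks with `r` steps. -/
noncomputable def connected (X : Type*) [Fintype X] [LinearOrder X] (r : ℕ) :
    Finset (ListWalk X) :=
  (monotone X r).filter fun w => w.IsConnected

theorem mem_connected {r : ℕ} {w : ListWalk X} :
    w ∈ connected X r ↔ (w.2.length = r ∧ IsMonotone w.2) ∧ w.IsConnected := by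
  classical
  simp only [connected, Finset.mem_filter, mem_monotone]

end ListWalk

/-! ### Gluing walks on the two blocks of a decomposition. -/

section Glue

variable {X Y Z : Type*}

/-- The permutation that acts as `σ` and `τ` on the two parts of a decomposition. -/
def gluePerm (e : Y ⊕ Z ≃ X) : Perm Y × Perm Z →* Perm X :=
  e.permCongrHom.toMonoidHom.comp (Perm.sumCongrHom Y Z)

@[simp] theorem gluePerm_inl (e : Y ⊕ Z ≃ X) (p : Perm Y × Perm Z) (y : Y) :
    gluePerm e p (e (Sum.inl y)) = e (Sum.inl (p.1 y)) := by
  simp [gluePerm, Equiv.permCongrHom, Perm.sumCongrHom]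

@[simp] theorem gluePerm_inr (e : Y ⊕ Z ≃ X) (p : Perm Y × Perm Z) (z : Z) :
    gluePerm e p (e (Sum.inr z)) = e (Sum.inr (p.2 z)) := by
  simp [gluePerm, Equiv.permCongrHom, Perm.sumCongrHom]

theorem gluePerm_injective (e : Y ⊕ Z ≃ X) : Function.Injective (gluePerm e) :=
  e.permCongrHom.injective.comp Perm.sumCongrHom_injective

theorem parts_gluePerm [Fintype X] [DecidableEq X] [Fintype Y] [DecidableEq Y] [Fintype Z]
    [DecidableEq Z] (e : Y ⊕ Z ≃ X) (p : Perm Y × Perm Z) :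
    (gluePerm e p).partition.parts = p.1.partition.parts + p.2.partition.parts := by
  rw [← parts_sumCongr, ← parts_permCongr e]
  rfl

theorem perm_ext_sum (e : Y ⊕ Z ≃ X) {σ τ : Perm X}
    (h1 : ∀ y, σ (e (Sum.inl y)) = τ (e (Sum.inl y)))
    (h2 : ∀ z, σ (e (Sum.inr z)) = τ (e (Sum.inr z))) : σ = τ := by
  ext x
  obtain ⟨y | z, rfl⟩ := e.surjective x
  · exact h1 y
  · exact h2 z

theorem gluePerm_swap_left [DecidableEq X] [DecidableEq Y] (e : Y ⊕ Z ≃ X) (a b : Y) :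
    gluePerm e (swap a b, 1) = swap (e (Sum.inl a)) (e (Sum.inl b)) := by
  refine perm_ext_sum e (fun y => ?_) (fun z => ?_)
  · have hi : Function.Injective fun y => e (Sum.inl y) := e.injective.comp Sum.inl_injective
    rw [gluePerm_inl]
    exact (hi.swap_apply a b y).symm
  · rw [gluePerm_inr, swap_apply_of_ne_of_ne] <;> simp

theorem gluePerm_swap_right [DecidableEq X] [DecidableEq Z] (e : Y ⊕ Z ≃ X) (a b : Z) :
    gluePerm e (1, swap a b) = swap (e (Sum.inr a)) (e (Sum.inr b)) := by
  refine perm_ext_sum e (fun y => ?_) (fun z => ?_)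
  · rw [gluePerm_inl, swap_apply_of_ne_of_ne] <;> simp
  · have hi : Function.Injective fun z => e (Sum.inr z) := e.injective.comp Sum.inr_injective
    rw [gluePerm_inr]
    exact (hi.swap_apply a b z).symm

/-- By finiteness it is enough that `σ` maps the left block into itself. -/
theorem exists_gluePerm [Finite Y] [Finite Z] (e : Y ⊕ Z ≃ X) (σ : Perm X)
    (h : ∀ x, σ x ∈ Set.range (fun y => e (Sum.inl y)) ↔ x ∈ Set.range (fun y => e (Sum.inl y))) :
    ∃ p, gluePerm e p = σ := by
  obtain ⟨p, hp⟩ := Perm.mem_sumCongrHom_range_of_perm_mapsTo_inl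
    (σ := e.permCongrHom.symm σ) (by
      rintro _ ⟨y, rfl⟩
      obtain ⟨y', hy'⟩ := (h (e (Sum.inl y))).2 ⟨y, rfl⟩
      refine ⟨y', e.injective ?_⟩
      simpa [Equiv.permCongrHom] using hy')
  refine ⟨p, ?_⟩
  have : gluePerm e p = e.permCongrHom (Perm.sumCongrHom Y Z p) := rfl
  rw [this, hp, MulEquiv.apply_symm_apply]

open ListWalk

/-- Push a list of steps forward. -/
def mapSteps (f : Y → X) (L : List (Y × Y)) : List (X × X) := L.map (Prod.map f f)

theorem exists_mapSteps {f : Y → X} {L : List (X × X)}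
    (h : ∀ a ∈ L, a.1 ∈ Set.range f ∧ a.2 ∈ Set.range f) : ∃ L', mapSteps f L' = L := by
  have : L ∈ Set.range (List.map (Prod.map f f)) := by
    rw [Set.range_list_map, Set.range_prodMap]
    exact h
  exact this

variable [LinearOrder X]

/-- The monotone walk whose restrictions to the two parts of a decomposition are given. -/
def glueWalk (e : Y ⊕ Z ≃ X) (v : ListWalk Y) (w : ListWalk Z) : ListWalk X :=
  (gluePerm e (v.1, w.1),
    (mapSteps (e ∘ Sum.inl) v.2).merge (mapSteps (e ∘ Sum.inr) w.2) fun a b => a.2 ≤ b.2)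

theorem mem_glueWalk {e : Y ⊕ Z ≃ X} {v : ListWalk Y} {w : ListWalk Z} {a : X × X} :
    a ∈ (glueWalk e v w).2 ↔
      (∃ b ∈ v.2, (e (Sum.inl b.1), e (Sum.inl b.2)) = a) ∨
        ∃ b ∈ w.2, (e (Sum.inr b.1), e (Sum.inr b.2)) = a := by
  simp only [glueWalk, mapSteps, List.mem_merge, List.mem_map]
  rfl

theorem length_glueWalk (e : Y ⊕ Z ≃ X) (v : ListWalk Y) (w : ListWalk Z) :
    (glueWalk e v w).2.length = v.2.length + w.2.length := by
  simp [glueWalk, mapSteps]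

theorem preserves_glueWalk {e : Y ⊕ Z ≃ X} {v : ListWalk Y} {w : ListWalk Z} {T : Set X} :
    (glueWalk e v w).Preserves T ↔ v.Preserves ((fun y => e (Sum.inl y)) ⁻¹' T) ∧
      w.Preserves ((fun z => e (Sum.inr z)) ⁻¹' T) := by
  constructor
  · rintro ⟨h1, h2⟩
    refine ⟨⟨fun y => ?_, fun b hb => ?_⟩, ⟨fun z => ?_, fun b hb => ?_⟩⟩
    · simpa [glueWalk] using h1 (e (Sum.inl y))
    · exact h2 _ (mem_glueWalk.2 (Or.inl ⟨b, hb, rfl⟩))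
    · simpa [glueWalk] using h1 (e (Sum.inr z))
    · exact h2 _ (mem_glueWalk.2 (Or.inr ⟨b, hb, rfl⟩))
  · rintro ⟨⟨h1, h2⟩, ⟨h3, h4⟩⟩
    refine ⟨fun x => ?_, fun a ha => ?_⟩
    · obtain ⟨y | z, rfl⟩ := e.surjective x
      · simpa [glueWalk] using h1 y
      · simpa [glueWalk] using h3 z
    · obtain ⟨b, hb, rfl⟩ | ⟨b, hb, rfl⟩ := mem_glueWalk.1 ha
      · exact h2 b hb
      · exact h4 b hb

theorem component_glueWalk_eq_iff {e : Y ⊕ Z ≃ X} {v : ListWalk Y} {w : ListWalk Z} {y₀ : Y} :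
    (glueWalk e v w).component (e (Sum.inl y₀)) = Set.range (fun y => e (Sum.inl y)) ↔
      v.IsConnected := by
  have hr : (fun z => e (Sum.inr z)) ⁻¹' Set.range (fun y => e (Sum.inl y)) = ∅ := by
    ext z; simp
  have key : ∀ T : Set Y, (fun y => e (Sum.inl y)) ⁻¹' ((fun y => e (Sum.inl y)) '' T) = T :=
    fun T => Set.preimage_image_eq T (e.injective.comp Sum.inl_injective)
  have key' : ∀ T : Set Y, (fun z => e (Sum.inr z)) ⁻¹' ((fun y => e (Sum.inl y)) '' T) = ∅ := by
    intro T; ext z; simp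
  have hw : w.Preserves ∅ := ⟨by simp, by simp⟩
  constructor
  · intro h
    -- The image of `T` in the left block is preserved by the glued walk, hence contains the whole
    -- orbit of the base point.
    have main : ∀ T : Set Y, v.Preserves T → y₀ ∈ T → T = Set.univ := by
      intro T hT hy
      have hP : (glueWalk e v w).Preserves ((fun y => e (Sum.inl y)) '' T) := by
        rw [preserves_glueWalk, key, key']
        exact ⟨hT, hw⟩
      have := component_subset hP ⟨y₀, hy, rfl⟩
      rw [h] at this
      refine Set.eq_univ_of_forall fun y => ?_
      obtain ⟨y', hy', h'⟩ := this ⟨y, rfl⟩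
      have : y' = y := Sum.inl_injective (e.injective h')
      exact this ▸ hy'
    intro T hT hne
    by_cases hy : y₀ ∈ T
    · exact main T hT hy
    · have := main _ hT.compl hy
      rw [Set.compl_univ_iff] at this
      exact absurd this hne.ne_empty
  · intro h
    apply Set.Subset.antisymm
    · refine component_subset ?_ ⟨y₀, rfl⟩
      rw [preserves_glueWalk, hr]
      refine ⟨?_, hw⟩
      rw [show (fun y => e (Sum.inl y)) ⁻¹' Set.range (fun y => e (Sum.inl y)) = Set.univ by
        ext y; simp]
      exact ⟨by simp, by simp⟩
    · rintro _ ⟨y, rfl⟩ T hT hy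
      have := h _ (preserves_glueWalk.1 hT).1 ⟨y₀, hy⟩
      have hy' : y ∈ (fun y => e (Sum.inl y)) ⁻¹' T := by rw [this]; trivial
      exact hy'

theorem stepProd_mapSteps_inl [DecidableEq Y] (e : Y ⊕ Z ≃ X) (L : List (Y × Y)) :
    stepProd (mapSteps (e ∘ Sum.inl) L) = gluePerm e (stepProd L, 1) := by
  induction L with
  | nil => exact (map_one (gluePerm e)).symm
  | cons a l ih =>
    have h : gluePerm e (stepProd (a :: l), 1) =
        gluePerm e (swap a.1 a.2, 1) * gluePerm e (stepProd l, 1) := by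
      rw [← map_mul]; simp [stepProd]
    rw [h, gluePerm_swap_left, ← ih]
    simp [stepProd, mapSteps]

theorem stepProd_mapSteps_inr [DecidableEq Z] (e : Y ⊕ Z ≃ X) (L : List (Z × Z)) :
    stepProd (mapSteps (e ∘ Sum.inr) L) = gluePerm e (1, stepProd L) := by
  induction L with
  | nil => exact (map_one (gluePerm e)).symm
  | cons a l ih =>
    have h : gluePerm e (1, stepProd (a :: l)) =
        gluePerm e (1, swap a.1 a.2) * gluePerm e (1, stepProd l) := by
      rw [← map_mul]; simp [stepProd]
    rw [h, gluePerm_swap_right, ← ih]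
    simp [stepProd, mapSteps]

/-- Transpositions in different blocks commute, so the order of interleaving does not affect the
product. -/
theorem endpoint_glueWalk [DecidableEq Y] [DecidableEq Z] (e : Y ⊕ Z ≃ X) (v : ListWalk Y)
    (w : ListWalk Z) :
    (glueWalk e v w).1 * stepProd (glueWalk e v w).2 =
      gluePerm e (v.1 * stepProd v.2, w.1 * stepProd w.2) := by
  have h : stepProd (glueWalk e v w).2 = gluePerm e (stepProd v.2, stepProd w.2) := by
    have : ∀ A B : List (X × X), (∀ a ∈ A, ∀ b ∈ B, Commute (swap a.1 a.2) (swap b.1 b.2)) →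
        stepProd (A.merge B fun a b => a.2 ≤ b.2) = stepProd A * stepProd B :=
      fun A B => prod_map_merge _ _ A B
    rw [glueWalk, this, stepProd_mapSteps_inl, stepProd_mapSteps_inr, ← map_mul]
    · simp
    · intro a ha b hb
      obtain ⟨a, -, rfl⟩ := List.mem_map.1 ha
      obtain ⟨b, -, rfl⟩ := List.mem_map.1 hb
      simp only [Prod.map_fst, Prod.map_snd, Function.comp_apply]
      rw [← gluePerm_swap_left, ← gluePerm_swap_right]
      exact Commute.map (by simp [Commute, SemiconjBy]) (gluePerm e)
  rw [h, glueWalk, ← map_mul]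
  rfl

variable [LinearOrder Y] [LinearOrder Z] {e : Y ⊕ Z ≃ X}

theorem isMonotone_mapSteps {f : Y → X} (hf : StrictMono f) {L : List (Y × Y)} :
    IsMonotone (mapSteps f L) ↔ IsMonotone L := by
  simp only [IsMonotone, mapSteps, List.pairwise_map, List.forall_mem_map, Prod.map_fst,
    Prod.map_snd, hf.lt_iff_lt, hf.le_iff_le]

theorem isMonotone_glueWalk (h1 : StrictMono (e ∘ Sum.inl)) (h2 : StrictMono (e ∘ Sum.inr))
    {v : ListWalk Y} {w : ListWalk Z} (hv : IsMonotone v.2) (hw : IsMonotone w.2) :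
    IsMonotone (glueWalk e v w).2 := by
  rw [← isMonotone_mapSteps h1] at hv
  rw [← isMonotone_mapSteps h2] at hw
  refine ⟨fun a ha => ?_, ?_⟩
  · rcases List.mem_merge.1 ha with ha | ha
    · exact hv.1 a ha
    · exact hw.1 a ha
  · have := List.pairwise_merge (le := fun a b : X × X => decide (a.2 ≤ b.2))
      (fun a b c hab hbc => by simp at *; exact hab.trans hbc)
      (fun a b => by simpa using le_total a.2 b.2) _ _
      (by simpa using hv.2) (by simpa using hw.2)
    simpa [glueWalk] using this

-- Both lists of steps are recovered from the merged one by asking in which block the larger entry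
-- `t` lies.
open Classical in
omit [LinearOrder Y] [LinearOrder Z] in
theorem glueWalk_injective {v v' : ListWalk Y} {w w' : ListWalk Z}
    (h : glueWalk e v w = glueWalk e v' w') : v = v' ∧ w = w' := by
  have h1 := gluePerm_injective e (congrArg Prod.fst h)
  have h2 : (glueWalk e v w).2 = (glueWalk e v' w').2 := congrArg Prod.snd h
  have hl : ∀ L : List (Y × Y), ∀ a ∈ mapSteps (e ∘ Sum.inl) L,
      decide (a.2 ∈ Set.range (e ∘ Sum.inl)) = true := by
    intro L a ha
    obtain ⟨a, -, rfl⟩ := List.mem_map.1 ha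
    simp
  have hr : ∀ L : List (Z × Z), ∀ a ∈ mapSteps (e ∘ Sum.inr) L,
      decide (a.2 ∈ Set.range (e ∘ Sum.inl)) = false := by
    intro L a ha
    obtain ⟨a, -, rfl⟩ := List.mem_map.1 ha
    simp
  have hi1 : Function.Injective (mapSteps (e ∘ Sum.inl) : List (Y × Y) → _) :=
    List.map_injective_iff.2
      ((e.injective.comp Sum.inl_injective).prodMap (e.injective.comp Sum.inl_injective))
  have hi2 : Function.Injective (mapSteps (e ∘ Sum.inr) : List (Z × Z) → _) :=
    List.map_injective_iff.2
      ((e.injective.comp Sum.inr_injective).prodMap (e.injective.comp Sum.inr_injective))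
  have e1 : mapSteps (e ∘ Sum.inl) v.2 = mapSteps (e ∘ Sum.inl) v'.2 := by
    rw [← filter_merge_left (fun a b => a.2 ≤ b.2) _ _ _ (hl v.2) (hr w.2),
      ← filter_merge_left (fun a b => a.2 ≤ b.2) _ _ _ (hl v'.2) (hr w'.2)]
    exact congrArg _ h2
  have e2 : mapSteps (e ∘ Sum.inr) w.2 = mapSteps (e ∘ Sum.inr) w'.2 := by
    rw [← filter_merge_right (fun a b => a.2 ≤ b.2) _ _ _ (hl v.2) (hr w.2),
      ← filter_merge_right (fun a b => a.2 ≤ b.2) _ _ _ (hl v'.2) (hr w'.2)]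
    exact congrArg _ h2
  exact ⟨Prod.ext (Prod.ext_iff.1 h1).1 (hi1 e1), Prod.ext (Prod.ext_iff.1 h1).2 (hi2 e2)⟩

-- A preserved block contains both ends of a step or neither, so the steps split by block. Merging
-- the two lists returns the original one, since `t` determines the block and both lists are sorted
-- by `t`.
open Classical in
theorem exists_glueWalk [Finite Y] [Finite Z] (h1 : StrictMono (e ∘ Sum.inl))
    (h2 : StrictMono (e ∘ Sum.inr)) {u : ListWalk X} (hu : IsMonotone u.2)
    (hp : u.Preserves (Set.range fun y => e (Sum.inl y))) :
    ∃ v w, IsMonotone v.2 ∧ IsMonotone w.2 ∧ glueWalk e v w = u := by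
  obtain ⟨p, hp1⟩ := exists_gluePerm e u.1 hp.1
  set P : X × X → Bool := fun a => decide (a.2 ∈ Set.range fun y => e (Sum.inl y)) with hP
  obtain ⟨A, hA⟩ : ∃ A, mapSteps (e ∘ Sum.inl) A = u.2.filter P := by
    refine exists_mapSteps fun a ha => ?_
    obtain ⟨ha, hPa⟩ := List.mem_filter.1 ha
    have hPa : a.2 ∈ Set.range fun y => e (Sum.inl y) := by simpa [hP] using hPa
    exact ⟨(hp.2 a ha).2 hPa, hPa⟩
  have hcompl : ∀ x, x ∉ (Set.range fun y => e (Sum.inl y)) → x ∈ Set.range (e ∘ Sum.inr) := by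
    intro x hx
    obtain ⟨y | z, rfl⟩ := e.surjective x
    · exact absurd ⟨y, rfl⟩ hx
    · exact ⟨z, rfl⟩
  obtain ⟨B, hB⟩ : ∃ B, mapSteps (e ∘ Sum.inr) B = u.2.filter fun a => !P a := by
    refine exists_mapSteps fun a ha => ?_
    obtain ⟨ha, hPa⟩ := List.mem_filter.1 ha
    have hPa : a.2 ∉ Set.range fun y => e (Sum.inl y) := by simpa [hP] using hPa
    exact ⟨hcompl _ fun h => hPa ((hp.2 a ha).1 h), hcompl _ hPa⟩
  have hmono : ∀ Q : X × X → Bool, IsMonotone (u.2.filter Q) := fun Q =>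
    ⟨fun a ha => hu.1 a (List.mem_of_mem_filter ha), hu.2.filter Q⟩
  have hmA : IsMonotone A := (isMonotone_mapSteps h1).1 (hA ▸ hmono _)
  have hmB : IsMonotone B := (isMonotone_mapSteps h2).1 (hB ▸ hmono _)
  refine ⟨(p.1, A), (p.2, B), hmA, hmB, Prod.ext hp1 ?_⟩
  have hl : ∀ a ∈ u.2.filter P, P a = true := fun a ha => (List.mem_filter.1 ha).2
  have hr : ∀ a ∈ u.2.filter (fun a => !P a), P a = false := fun a ha => by
    simpa using (List.mem_filter.1 ha).2
  refine sorted_ext_filter Prod.snd P (fun a b hab => by simp only [hP, hab])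
    (isMonotone_glueWalk (v := (p.1, A)) (w := (p.2, B)) h1 h2 hmA hmB).2 hu.2 ?_ ?_
  · simp only [glueWalk, hA, hB]
    exact filter_merge_left _ _ _ _ hl hr
  · simp only [glueWalk, hA, hB]
    exact filter_merge_right _ _ _ _ hl hr

end Glue

end MonotoneHurwitz

namespace MonotoneHurwitz

open Equiv ListWalk Finset

/-! ### Weighted counts and the recursion on the component of a point. -/

variable {S : Type*} [CommRing S] (f g : ℕ → S)

/-- The multiplicative weight of a walk, computed from the cycles of its two endpoints. -/
noncomputable def weight {X : Type*} [Fintype X] [LinearOrder X] (w : ListWalk X) : S :=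
  (w.1.partition.parts.map f).prod * ((w.1 * stepProd w.2).partition.parts.map g).prod

/-- The weighted number of monotone walks with `r` steps. -/
noncomputable def total (X : Type*) [Fintype X] [LinearOrder X] (r : ℕ) : S :=
  ∑ w ∈ ListWalk.monotone X r, weight f g w

/-- The weighted number of connected monotone walks with `r` steps. -/
noncomputable def connTotal (X : Type*) [Fintype X] [LinearOrder X] (r : ℕ) : S :=
  ∑ w ∈ connected X r, weight f g w

theorem weight_glueWalk {X Y Z : Type*} [Fintype X] [LinearOrder X] [Fintype Y] [LinearOrder Y]
    [Fintype Z] [LinearOrder Z] (e : Y ⊕ Z ≃ X) (v : ListWalk Y) (w : ListWalk Z) :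
    weight f g (glueWalk e v w) = weight f g v * weight f g w := by
  rw [weight, endpoint_glueWalk, parts_gluePerm, glueWalk, parts_gluePerm]
  simp only [Multiset.map_add, Multiset.prod_add, weight]
  ring

-- Gluing is a weight-preserving bijection. The orbit condition on the glued walk is connectedness
-- of its left piece, and lengths add. No binomial in `r` appears because the monotone interleaving
-- is forced.
open Classical in
theorem sum_component_eq {X Y Z : Type*} [Fintype X] [LinearOrder X] [Fintype Y] [LinearOrder Y]
    [Fintype Z] [LinearOrder Z] (e : Y ⊕ Z ≃ X) (h1 : StrictMono (e ∘ Sum.inl))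
    (h2 : StrictMono (e ∘ Sum.inr)) (y₀ : Y) (r : ℕ) :
    ∑ w ∈ ListWalk.monotone X r with
        w.component (e (Sum.inl y₀)) = Set.range (fun y => e (Sum.inl y)), weight f g w =
      ∑ p ∈ antidiagonal r, connTotal f g Y p.1 * total f g Z p.2 := by
  have hexp : ∀ p : ℕ × ℕ, connTotal f g Y p.1 * total f g Z p.2 =
      ∑ q ∈ connected Y p.1 ×ˢ ListWalk.monotone Z p.2, weight f g q.1 * weight f g q.2 :=
    fun p => by rw [connTotal, total, sum_mul_sum, sum_product]
  simp_rw [hexp]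
  rw [sum_sigma']
  symm
  refine sum_bij (fun q _ => glueWalk e q.2.1 q.2.2) ?_ ?_ ?_ ?_
  · rintro ⟨p, v, w⟩ hq
    simp only [mem_sigma, HasAntidiagonal.mem_antidiagonal, mem_product, mem_connected, mem_monotone] at hq
    obtain ⟨hp, ⟨⟨hv1, hv2⟩, hv3⟩, hw1, hw2⟩ := hq
    simp only [mem_filter, mem_monotone, length_glueWalk, component_glueWalk_eq_iff]
    exact ⟨⟨by omega, isMonotone_glueWalk h1 h2 hv2 hw2⟩, hv3⟩
  · rintro ⟨⟨p1, p2⟩, v, w⟩ hq ⟨⟨p1', p2'⟩, v', w'⟩ hq' h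
    simp only [mem_sigma, HasAntidiagonal.mem_antidiagonal, mem_product, mem_connected, mem_monotone] at hq hq'
    obtain ⟨rfl, rfl⟩ := glueWalk_injective h
    obtain ⟨-, ⟨⟨rfl, -⟩, -⟩, rfl, -⟩ := hq
    obtain ⟨-, ⟨⟨rfl, -⟩, -⟩, rfl, -⟩ := hq'
    rfl
  · intro u hu
    simp only [mem_filter, mem_monotone] at hu
    obtain ⟨⟨hu1, hu2⟩, hu3⟩ := hu
    obtain ⟨v, w, hv, hw, rfl⟩ := exists_glueWalk h1 h2 hu2
      (hu3 ▸ preserves_component u (e (Sum.inl y₀)))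
    rw [component_glueWalk_eq_iff] at hu3
    refine ⟨⟨(v.2.length, w.2.length), v, w⟩, ?_, rfl⟩
    simp only [mem_sigma, HasAntidiagonal.mem_antidiagonal, mem_product, mem_connected, mem_monotone]
    exact ⟨by rw [← hu1, length_glueWalk], ⟨⟨trivial, hv⟩, hu3⟩, trivial, hw⟩
  · rintro ⟨p, v, w⟩ -
    exact (weight_glueWalk f g e v w).symm

-- Both `A` and its complement are relabelled increasingly by initial segments, which respects
-- monotonicity of walks.
open Classical in
theorem sum_component_finset {n : ℕ} (A : Finset (Fin (n + 1))) (hA : 0 ∈ A) (r : ℕ) :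
    ∑ w ∈ ListWalk.monotone (Fin (n + 1)) r with w.component 0 = (A : Set (Fin (n + 1))), weight f g w =
      ∑ p ∈ antidiagonal r, connTotal f g (Fin (#A)) p.1 * total f g (Fin (#Aᶜ)) p.2 := by
  let e := finSumEquivOfFinset (s := A) rfl rfl
  have hr : Set.range (fun y => e (Sum.inl y)) = A := by
    have : (fun y => e (Sum.inl y)) = A.orderEmbOfFin rfl := by
      ext y; simp [e]
    rw [this, range_orderEmbOfFin]
  obtain ⟨y₀, hy⟩ : (0 : Fin (n + 1)) ∈ Set.range (fun y => e (Sum.inl y)) := by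
    rw [hr]; exact hA
  have h1 : StrictMono (e ∘ Sum.inl) := by
    have : e ∘ Sum.inl = A.orderEmbOfFin rfl := by ext y; simp [e]
    rw [this]; exact OrderEmbedding.strictMono _
  have h2 : StrictMono (e ∘ Sum.inr) := by
    have : e ∘ Sum.inr = Aᶜ.orderEmbOfFin rfl := by ext y; simp [e]
    rw [this]; exact OrderEmbedding.strictMono _
  rw [← sum_component_eq f g e h1 h2 y₀ r, hr, show e (Sum.inl y₀) = 0 from hy]

/-- Splitting a monotone walk into the component of the point `0` and the rest. -/
theorem total_succ (n r : ℕ) :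
    total f g (Fin (n + 1)) r = ∑ k ∈ range (n + 1), n.choose k •
      ∑ p ∈ antidiagonal r, connTotal f g (Fin (k + 1)) p.1 * total f g (Fin (n - k)) p.2 := by
  classical
  let h : ℕ → S := fun k =>
    ∑ p ∈ antidiagonal r, connTotal f g (Fin (k + 1)) p.1 * total f g (Fin (n - k)) p.2
  have step : total f g (Fin (n + 1)) r =
      ∑ T ∈ (univ.erase (0 : Fin (n + 1))).powerset, h (#T) := by
    -- Walks are sorted by the component of `0` with `0` itself removed. A subset `T` of the other
    -- `n` points stands for the component `insert 0 T`, whence `k + 1` and `n.choose k`.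
    rw [total, ← sum_fiberwise_of_maps_to
      (t := (univ.erase (0 : Fin (n + 1))).powerset)
      (g := fun w => (univ.filter fun x => x ∈ w.component 0).erase 0)]
    · refine sum_congr rfl fun T hT => ?_
      have h0 : (0 : Fin (n + 1)) ∉ T := fun h0 => by simpa using mem_powerset.1 hT h0
      have hc : #(insert 0 T)ᶜ = n - #T := by
        rw [card_compl, card_insert_of_notMem h0, Fintype.card_fin]; omega
      have := sum_component_finset f g (insert 0 T) (mem_insert_self _ _) r
      rw [hc, card_insert_of_notMem h0] at this
      refine Eq.trans ?_ this
      refine sum_congr (filter_congr fun w _ => ?_) fun _ _ => rfl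
      constructor
      · rintro rfl
        rw [insert_erase (by simpa using mem_component_self w 0)]
        ext x; simp
      · intro hw
        ext x
        simp only [hw, mem_erase, mem_filter, mem_univ, true_and, coe_insert, Set.mem_insert_iff,
          mem_coe]
        exact ⟨fun hx => hx.2.resolve_left hx.1, fun hx => ⟨fun h => h0 (h ▸ hx), Or.inr hx⟩⟩
    · intro w _
      exact mem_powerset.2 (erase_subset_erase _ (subset_univ _))
  rw [step, sum_powerset_apply_card]
  simp [h]

theorem total_zero (r : ℕ) : total f g (Fin 0) r = if r = 0 then 1 else 0 := by
  split_ifs with hr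
  · subst hr
    have : ListWalk.monotone (Fin 0) 0 = {(1, [])} := by
      ext w
      rw [mem_monotone, mem_singleton]
      constructor
      · rintro ⟨h, -⟩
        exact Prod.ext (Subsingleton.elim _ _) (List.length_eq_zero_iff.1 h)
      · rintro rfl
        simp [IsMonotone]
    rw [total, this, sum_singleton]
    simp [weight, stepProd, Perm.parts_partition]
  · refine sum_eq_zero fun w hw => ?_
    obtain ⟨h, -⟩ := mem_monotone.1 hw
    rcases hl : w.2 with _ | ⟨a, l⟩
    · simp [hl] at h; omega
    · exact a.1.elim0

end MonotoneHurwitz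

namespace MonotoneHurwitz

open Equiv ListWalk Module

/-! ### The Riemann–Hurwitz relation by linear algebra over `ℚ`. -/

section RiemannHurwitz

variable {X : Type*}

/-- The functions that are constant on the cycles of a permutation. -/
def invariants (σ : Perm X) : Submodule ℚ (X → ℚ) where
  carrier := {f | ∀ x, f (σ x) = f x}
  add_mem' hf hg x := by simp [hf x, hg x]
  zero_mem' x := rfl
  smul_mem' c f hf x := by simp [hf x]

/-- The functions that take the same value at two points. -/
def equalizing (x y : X) : Submodule ℚ (X → ℚ) :=
  LinearMap.ker (LinearMap.proj (R := ℚ) (φ := fun _ : X => ℚ) x - LinearMap.proj y)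

theorem mem_invariants {σ : Perm X} {f : X → ℚ} : f ∈ invariants σ ↔ ∀ x, f (σ x) = f x := Iff.rfl

theorem mem_equalizing {x y : X} {f : X → ℚ} : f ∈ equalizing x y ↔ f x = f y := by
  simp [equalizing, sub_eq_zero]

variable [Fintype X]

/-- `equalizing x y` is the kernel of one linear functional, so its codimension is at most one. -/
theorem finrank_le_inf_equalizing (V : Submodule ℚ (X → ℚ)) (x y : X) :
    finrank ℚ V ≤ finrank ℚ (V ⊓ equalizing x y : Submodule ℚ (X → ℚ)) + 1 := by
  have h1 := Submodule.finrank_sup_add_finrank_inf_eq V (equalizing x y)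
  have h2 := LinearMap.finrank_range_add_finrank_ker
    (LinearMap.proj (R := ℚ) (φ := fun _ : X => ℚ) x - LinearMap.proj y)
  have h3 := Submodule.finrank_le (LinearMap.range
    (LinearMap.proj (R := ℚ) (φ := fun _ : X => ℚ) x - LinearMap.proj y))
  have h4 := Submodule.finrank_le (V ⊔ equalizing x y)
  rw [finrank_self] at h3
  rw [← equalizing] at h2
  omega

variable [DecidableEq X]

theorem card_quotient_sameCycle (σ : Perm X) :
    Nat.card (Quotient (Perm.SameCycle.setoid σ)) = Multiset.card σ.partition.parts := by
  classical
  -- `F` names the cycle of a point: a fixed point by itself, any other point by its cycle factor.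
  -- This matches the two summands of `partition.parts`.
  let F : X → Perm X ⊕ X := fun x => if σ x = x then Sum.inr x else Sum.inl (σ.cycleOf x)
  have hF : ∀ x y, σ.SameCycle x y ↔ F x = F y := by
    intro x y
    by_cases hx : σ x = x <;> by_cases hy : σ y = y
    · simp only [F, hx, hy, if_true, Sum.inr.injEq]
      exact ⟨fun h => h.eq_of_left hx, fun h => h ▸ Perm.SameCycle.refl _ _⟩
    · simp only [F, hx, hy, if_true, if_false, reduceCtorEq, iff_false]
      exact fun h => hy ((h.apply_eq_self_iff).1 hx)
    · simp only [F, hx, hy, if_true, if_false, reduceCtorEq, iff_false]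
      exact fun h => hx ((h.apply_eq_self_iff).2 hy)
    · simp only [F, hx, hy, if_false, Sum.inl.injEq]
      exact Perm.sameCycle_iff_cycleOf_eq_of_mem_support (Perm.mem_support.2 hx)
        (Perm.mem_support.2 hy)
  have hinj : Function.Injective (Quotient.lift F fun x y h => (hF x y).1 h :
      Quotient (Perm.SameCycle.setoid σ) → Perm X ⊕ X) := by
    rintro ⟨x⟩ ⟨y⟩ h
    exact Quotient.sound ((hF x y).2 h)
  have hrange : Set.range (Quotient.lift F fun x y h => (hF x y).1 h :
      Quotient (Perm.SameCycle.setoid σ) → Perm X ⊕ X) =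
        (σ.cycleFactorsFinset.disjSum σ.supportᶜ : Finset (Perm X ⊕ X)) := by
    ext z
    rw [show Set.range (Quotient.lift F fun x y h => (hF x y).1 h :
      Quotient (Perm.SameCycle.setoid σ) → Perm X ⊕ X) = Set.range F from Set.range_quot_lift _]
    constructor
    · rintro ⟨x, rfl⟩
      by_cases hx : σ x = x
      · simp [F, hx]
      · simp [F, hx, Perm.cycleOf_mem_cycleFactorsFinset_iff]
    · intro hz
      rcases z with c | x
      · simp only [Finset.mem_coe, Finset.inl_mem_disjSum] at hz
        obtain ⟨x, hx⟩ := (Perm.mem_cycleFactorsFinset_iff.1 hz).1.nonempty_support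
        have hxs := Perm.mem_cycleFactorsFinset_support_le hz hx
        refine ⟨x, ?_⟩
        simp only [F, if_neg (Perm.mem_support.1 hxs)]
        rw [Perm.cycle_is_cycleOf hx hz]
      · refine ⟨x, ?_⟩
        have : σ x = x := by simpa using hz
        simp [F, this]
  rw [← Nat.card_range_of_injective hinj, hrange, Nat.card_coe_set_eq, Set.ncard_coe_finset,
    Finset.card_disjSum, Perm.parts_partition, Multiset.card_add, Multiset.card_replicate,
    Finset.card_compl, Perm.cycleType_def, Multiset.card_map]
  rfl

/-- Invariant functions are exactly the functions on the set of cycles. -/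
theorem finrank_invariants (σ : Perm X) :
    finrank ℚ (invariants σ) = Multiset.card σ.partition.parts := by
  classical
  have hr : LinearMap.range (LinearMap.funLeft ℚ ℚ
      (Quotient.mk (Perm.SameCycle.setoid σ))) = invariants σ := by
    ext f
    constructor
    · rintro ⟨f, rfl⟩ x
      exact congrArg f (Quotient.sound (Perm.sameCycle_apply_left.2 (Perm.SameCycle.refl σ x)))
    · intro hf
      have key : ∀ x y, σ.SameCycle x y → f x = f y := by
        intro x y h
        obtain ⟨n, rfl⟩ := h.exists_nat_pow_eq
        induction n with
        | zero => rfl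
        | succ n ih =>
          rw [pow_succ', Perm.mul_apply, hf]
          exact ih ⟨n, by simp⟩
      exact ⟨Quotient.lift f key, rfl⟩
  rw [← hr, LinearMap.finrank_range_of_inj
    (LinearMap.funLeft_injective_of_surjective _ _ _ Quotient.mk_surjective),
    finrank_fintype_fun_eq_card, ← Nat.card_eq_fintype_card, card_quotient_sameCycle]

/-- Fixed points enter the exponent twice, once as points and once as parts, so they do not change
the sign. -/
theorem sign_eq_neg_one_pow (σ : Perm X) :
    ((Perm.sign σ : ℤˣ) : ℤ) =
      (-1) ^ (Fintype.card X + Multiset.card σ.partition.parts) := by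
  have h := σ.support.card_le_univ
  rw [Perm.sign_of_cycleType, Perm.parts_partition, Multiset.card_add, Multiset.card_replicate,
    Perm.sum_cycleType]
  push_cast
  obtain ⟨k, hk⟩ := Nat.exists_eq_add_of_le h
  rw [hk, Nat.add_sub_cancel_left, show σ.support.card + k + (Multiset.card σ.cycleType + k) =
    σ.support.card + Multiset.card σ.cycleType + (k + k) by ring, pow_add _ _ (k + k),
    Even.neg_one_pow ⟨k, rfl⟩, mul_one]

omit [Fintype X] in
-- A function with equal values at `x` and `y` does not notice the swap.
theorem invariants_inf_equalizing_mul_swap (σ : Perm X) (x y : X) :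
    invariants (σ * swap x y) ⊓ equalizing x y = invariants σ ⊓ equalizing x y := by
  ext f
  simp only [Submodule.mem_inf, mem_invariants, mem_equalizing, Perm.mul_apply]
  refine and_congr_left fun h => ?_
  have hs : ∀ z, f (swap x y z) = f z := by
    intro z
    rw [swap_apply_def]
    split_ifs with h1 h2
    · rw [h1, h]
    · rw [h2, h]
    · rfl
  constructor
  · intro H z
    have := H (swap x y z)
    rwa [swap_apply_self, hs] at this
  · intro H z
    rw [H, hs]

theorem card_parts_mul_swap_le (σ : Perm X) (x y : X) :
    Multiset.card (σ * swap x y).partition.parts ≤ Multiset.card σ.partition.parts + 1 := by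
  rw [← finrank_invariants, ← finrank_invariants]
  refine (finrank_le_inf_equalizing _ x y).trans ?_
  rw [invariants_inf_equalizing_mul_swap]
  exact Nat.succ_le_succ (Submodule.finrank_mono inf_le_left)

/-- The hypothesis says that `x` and `y` lie in different cycles, which the swap joins. Dimensions
exclude an increase and the sign excludes equality. -/
theorem card_parts_mul_swap_lt (σ : Perm X) {x y : X} (hxy : x ≠ y)
    (h : ¬ invariants σ ≤ equalizing x y) :
    Multiset.card (σ * swap x y).partition.parts < Multiset.card σ.partition.parts := by
  have h1 : Multiset.card (σ * swap x y).partition.parts ≤ Multiset.card σ.partition.parts := by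
    rw [← finrank_invariants, ← finrank_invariants]
    refine (finrank_le_inf_equalizing _ x y).trans ?_
    rw [invariants_inf_equalizing_mul_swap]
    exact Submodule.finrank_lt_finrank_of_lt (inf_lt_left.2 h)
  refine lt_of_le_of_ne h1 fun heq => ?_
  have h2 := sign_eq_neg_one_pow (σ * swap x y)
  rw [heq, ← sign_eq_neg_one_pow σ, Perm.sign_mul, Perm.sign_swap hxy] at h2
  rcases Int.units_eq_one_or (Perm.sign σ) with h3 | h3 <;> simp [h3] at h2

/-- The functions that are constant on the orbits of the monodromy group of a walk. -/
def walkInvariants (w : ListWalk X) : Submodule ℚ (X → ℚ) where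
  carrier := {f | (∀ x, f (w.1 x) = f x) ∧ ∀ e ∈ w.2, f e.1 = f e.2}
  add_mem' hf hg := ⟨fun x => by simp [hf.1 x, hg.1 x], fun e he => by simp [hf.2 e he, hg.2 e he]⟩
  zero_mem' := ⟨fun _ => rfl, fun _ _ => rfl⟩
  smul_mem' c f hf := ⟨fun x => by simp [hf.1 x], fun e he => by simp [hf.2 e he]⟩

omit [Fintype X] in
theorem walkInvariants_le_invariants (ρ : Perm X) (L : List (X × X)) :
    walkInvariants (ρ, L) ≤ invariants (ρ * stepProd L) := by
  rintro f ⟨h1, h2⟩ x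
  rw [Perm.mul_apply, h1]
  dsimp only at h2
  clear h1
  induction L with
  | nil => rfl
  | cons a l ih =>
    have h := h2 a (by simp)
    have h3 : stepProd (a :: l) x = swap a.1 a.2 (stepProd l x) := by simp [stepProd]
    rw [h3, ← ih fun e he => h2 e (by simp [he]), swap_apply_def]
    split_ifs with h4 h5
    · rw [h4, h]
    · rw [h5, h]
    · rfl

/-- Append one step. If it lies inside an orbit, the endpoint gains at most one cycle, paid for by
the length. If it joins two orbits, the endpoint loses a cycle, while the right side changes by at
least `1 - 2 = -1`. With no steps, both sides are twice the number of cycles of `ρ`. -/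
theorem card_parts_add_card_parts_le (ρ : Perm X) (L : List (X × X)) (hL : ∀ e ∈ L, e.1 ≠ e.2) :
    Multiset.card ρ.partition.parts + Multiset.card (ρ * stepProd L).partition.parts ≤
      L.length + 2 * finrank ℚ (walkInvariants (ρ, L)) := by
  induction L using List.reverseRecOn with
  | nil =>
    have : walkInvariants (ρ, []) = invariants ρ := by
      ext f
      exact ⟨fun h => h.1, fun h => ⟨h, by simp⟩⟩
    rw [this, finrank_invariants]
    simp [stepProd]
    omega
  | append_singleton L a ih =>
    have ih := ih fun e he => hL e (by simp [he])
    have ha := hL a (by simp)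
    have h1 : ρ * stepProd (L ++ [a]) = ρ * stepProd L * swap a.1 a.2 := by
      simp [stepProd, mul_assoc]
    have h2 : walkInvariants (ρ, L ++ [a]) = walkInvariants (ρ, L) ⊓ equalizing a.1 a.2 := by
      ext f
      rw [Submodule.mem_inf, mem_equalizing]
      constructor
      · rintro ⟨h1, h2⟩
        exact ⟨⟨h1, fun e he => h2 e (List.mem_append_left _ he)⟩, h2 a (by simp)⟩
      · rintro ⟨⟨h1, h2⟩, h3⟩
        refine ⟨h1, fun e he => ?_⟩
        rcases List.mem_append.1 he with he | he
        · exact h2 e he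
        · rw [List.mem_singleton.1 he, h3]
    rw [h1, List.length_append, List.length_singleton]
    by_cases hle : walkInvariants (ρ, L) ≤ equalizing a.1 a.2
    · rw [h2, inf_eq_left.2 hle]
      have := card_parts_mul_swap_le (ρ * stepProd L) a.1 a.2
      omega
    · have h3 := card_parts_mul_swap_lt (ρ * stepProd L) ha
        fun h => hle ((walkInvariants_le_invariants ρ L).trans h)
      have h4 := finrank_le_inf_equalizing (walkInvariants (ρ, L)) a.1 a.2
      rw [h2]
      omega

theorem even_card_parts_add_card_parts (ρ : Perm X) (L : List (X × X))
    (hL : ∀ e ∈ L, e.1 ≠ e.2) :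
    Even (Multiset.card ρ.partition.parts + Multiset.card (ρ * stepProd L).partition.parts +
      L.length) := by
  have hs : ((Perm.sign (stepProd L) : ℤˣ) : ℤ) = (-1) ^ L.length := by
    induction L with
    | nil => simp [stepProd]
    | cons a l ih =>
      have h3 : stepProd (a :: l) = swap a.1 a.2 * stepProd l := by simp [stepProd]
      rw [h3, Perm.sign_mul, Perm.sign_swap (hL a (by simp)), Units.val_mul,
        ih fun e he => hL e (by simp [he]), List.length_cons, pow_succ']
      rfl
  have h := sign_eq_neg_one_pow (ρ * stepProd L)
  rw [Perm.sign_mul, Units.val_mul, hs, sign_eq_neg_one_pow ρ] at h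
  rw [← pow_add] at h
  have h2 := congrArg (· * (-1 : ℤ) ^ (Fintype.card X +
    Multiset.card (ρ * stepProd L).partition.parts)) h
  simp only [← pow_add] at h2
  rw [Even.neg_one_pow (n := (_ + _) + (_ + _)) ⟨_, rfl⟩] at h2
  have h3 := neg_one_pow_eq_one_iff_even (R := ℤ) (by norm_num) |>.1 h2
  rw [Nat.even_iff] at h3 ⊢
  omega

/-- The Riemann–Hurwitz formula: the genus of a connected walk is a natural number. -/
theorem exists_genus [Nonempty X] {w : ListWalk X} (hw : w.IsConnected)
    (hL : ∀ e ∈ w.2, e.1 ≠ e.2) :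
    ∃ g : ℕ, w.2.length + 2 = 2 * g + (Multiset.card w.1.partition.parts +
      Multiset.card (w.1 * stepProd w.2).partition.parts) := by
  -- Level sets of an invariant function are preserved, so on a connected walk only constants are
  -- invariant.
  have h1 : finrank ℚ (walkInvariants w) ≤ 1 := by
    refine finrank_le_one (⟨fun _ => 1, fun _ => rfl, fun _ _ => rfl⟩ : walkInvariants w) ?_
    rintro ⟨f, hf⟩
    obtain ⟨x₀⟩ := ‹Nonempty X›
    refine ⟨f x₀, Subtype.ext (funext fun x => ?_)⟩
    have hP : w.Preserves {x | f x = f x₀} :=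
      ⟨fun x => by simp [hf.1 x], fun e he => by simp [hf.2 e he]⟩
    have := hw _ hP ⟨x₀, rfl⟩
    have hx : x ∈ {x | f x = f x₀} := by rw [this]; trivial
    simpa using hx.symm
  have h2 := card_parts_add_card_parts_le w.1 w.2 hL
  obtain ⟨m, hm⟩ := even_card_parts_add_card_parts w.1 w.2 hL
  -- The two cycle counts and the length sum to `2m`, which gives the witness. The bound `h2` with
  -- `h3` yields `m ≤ w.2.length + 1`, so nothing is truncated.
  refine ⟨w.2.length + 1 - m, ?_⟩
  have h3 : finrank ℚ (walkInvariants (w.1, w.2)) ≤ 1 := h1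
  omega

end RiemannHurwitz

end MonotoneHurwitz

namespace MonotoneHurwitz

open Equiv ListWalk Finset

/-! ### From weighted sums back to walk counts. -/

section Counting

variable {d : ℕ}

/-- The partition formed by the cycle lengths of a permutation. -/
noncomputable def cyclePartition (σ : Perm (Fin d)) : d.Partition where
  parts := cycles σ
  parts_pos := σ.partition.parts_pos
  parts_sum := σ.partition.parts_sum.trans (Fintype.card_fin d)

theorem cyclePartition_eq_iff {σ : Perm (Fin d)} {α : d.Partition} :
    cyclePartition σ = α ↔ cycles σ = α.parts := by
  rw [Nat.Partition.ext_iff]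
  rfl

/-- The walk with the given steps, as a list. -/
def toListWalk {r : ℕ} (w : Perm (Fin d) × (Fin r → Fin d × Fin d)) : ListWalk (Fin d) :=
  (w.1, List.ofFn w.2)

theorem toListWalk_injective {r : ℕ} :
    Function.Injective (toListWalk : Perm (Fin d) × (Fin r → Fin d × Fin d) → _) := by
  intro v w h
  exact Prod.ext (Prod.ext_iff.1 h).1 (List.ofFn_injective (Prod.ext_iff.1 h).2)

theorem exists_toListWalk {r : ℕ} {w : ListWalk (Fin d)} (h : w.2.length = r) :
    ∃ v : Perm (Fin d) × (Fin r → Fin d × Fin d), toListWalk v = w := by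
  subst h
  exact ⟨(w.1, w.2.get), by simp [toListWalk]⟩

theorem isMonotone_ofFn {r : ℕ} {e : Fin r → Fin d × Fin d} :
    IsMonotone (List.ofFn e) ↔ IsMonotoneSteps e := by
  rw [IsMonotone, IsMonotoneSteps, List.forall_mem_ofFn_iff, List.pairwise_ofFn]
  refine and_congr_right fun _ => ⟨fun h i j hij => ?_, fun h i j hij => h i j hij.le⟩
  rcases hij.eq_or_lt with rfl | hij
  · exact le_rfl
  · exact h hij

theorem endpoint_eq {r : ℕ} (w : Perm (Fin d) × (Fin r → Fin d × Fin d)) :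
    (toListWalk w).1 * stepProd (toListWalk w).2 = endpoint w.1 w.2 := by
  simp only [toListWalk, stepProd, endpoint, List.map_ofFn]
  rfl

/-- Group orbits are preserved sets. Conversely, a set preserved by the generators is preserved by
the group they generate. -/
theorem isConnected_toListWalk {r : ℕ} (w : Perm (Fin d) × (Fin r → Fin d × Fin d)) :
    (toListWalk w).IsConnected ↔ IsConnectedWalk w.1 w.2 := by
  constructor
  · intro h x y
    have hP : (toListWalk w).Preserves
        {y | ∃ σ ∈ Subgroup.closure (insert w.1 (Set.range (edge w.2))), σ x = y} := by
      have key : ∀ τ ∈ insert w.1 (Set.range (edge w.2)), ∀ y,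
          (∃ σ ∈ Subgroup.closure (insert w.1 (Set.range (edge w.2))), σ x = τ y) ↔
            ∃ σ ∈ Subgroup.closure (insert w.1 (Set.range (edge w.2))), σ x = y := by
        intro τ hτ y
        have hτ := Subgroup.subset_closure hτ
        constructor
        · rintro ⟨σ, hσ, h⟩
          exact ⟨τ⁻¹ * σ, mul_mem (inv_mem hτ) hσ, by simp [h]⟩
        · rintro ⟨σ, hσ, h⟩
          exact ⟨τ * σ, mul_mem hτ hσ, by simp [h]⟩
      refine ⟨key w.1 (Set.mem_insert _ _), fun e he => ?_⟩
      obtain ⟨i, rfl⟩ := List.mem_ofFn.1 he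
      have := key (edge w.2 i) (Set.mem_insert_of_mem _ ⟨i, rfl⟩) (w.2 i).2
      simpa [edge] using this
    have := h _ hP ⟨x, 1, one_mem _, rfl⟩
    exact (Set.eq_univ_iff_forall.1 this) y
  · rintro h T hT ⟨x, hx⟩
    refine Set.eq_univ_of_forall fun y => ?_
    obtain ⟨σ, hσ, rfl⟩ := h x y
    suffices ∀ z, σ z ∈ T ↔ z ∈ T from (this x).2 hx
    induction hσ using Subgroup.closure_induction with
    | mem τ hτ =>
      rcases hτ with rfl | ⟨i, rfl⟩
      · exact hT.1
      · intro z
        have := hT.2 (w.2 i) (List.mem_ofFn.2 ⟨i, rfl⟩)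
        rw [edge, swap_apply_def]
        split_ifs with h1 h2
        · rw [h1, this]
        · rw [h2, this]
        · rfl
    | one => simp
    | mul a b _ _ ha hb => intro z; rw [Perm.mul_apply, ha, hb]
    | inv a _ ha => intro z; rw [← ha (a⁻¹ z)]; simp

open Classical in
theorem walkCount_eq_card (r : ℕ) (α β : d.Partition) :
    walkCount r α β = #{w ∈ ListWalk.monotone (Fin d) r |
      cyclePartition w.1 = α ∧ cyclePartition (w.1 * stepProd w.2) = β} := by
  rw [walkCount, ← Set.ncard_image_of_injective _ toListWalk_injective, ← Set.ncard_coe_finset]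
  congr 1
  ext w
  simp only [Set.mem_image, coe_filter, Set.mem_ofPred_eq, mem_monotone, cyclePartition_eq_iff]
  constructor
  · rintro ⟨v, ⟨h1, h2, h3⟩, rfl⟩
    rw [endpoint_eq]
    exact ⟨⟨by simp [toListWalk], isMonotone_ofFn.2 h2⟩, h1, h3⟩
  · rintro ⟨⟨h1, h2⟩, h3, h4⟩
    obtain ⟨v, rfl⟩ := exists_toListWalk h1
    rw [endpoint_eq] at h4
    exact ⟨v, ⟨h3, isMonotone_ofFn.1 h2, h4⟩, rfl⟩

open Classical in
theorem connectedWalkCount_eq_card (r : ℕ) (α β : d.Partition) :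
    connectedWalkCount r α β = #{w ∈ connected (Fin d) r |
      cyclePartition w.1 = α ∧ cyclePartition (w.1 * stepProd w.2) = β} := by
  rw [connectedWalkCount, ← Set.ncard_image_of_injective _ toListWalk_injective,
    ← Set.ncard_coe_finset]
  congr 1
  ext w
  simp only [Set.mem_image, coe_filter, Set.mem_ofPred_eq, mem_connected, cyclePartition_eq_iff]
  constructor
  · rintro ⟨v, ⟨⟨h1, h2, h3⟩, h4⟩, rfl⟩
    rw [endpoint_eq]
    exact ⟨⟨⟨by simp [toListWalk], isMonotone_ofFn.2 h2⟩, (isConnected_toListWalk v).2 h4⟩, h1, h3⟩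
  · rintro ⟨⟨⟨h1, h2⟩, h5⟩, h3, h4⟩
    obtain ⟨v, rfl⟩ := exists_toListWalk h1
    rw [endpoint_eq] at h4
    exact ⟨v, ⟨⟨h3, isMonotone_ofFn.1 h2, h4⟩, (isConnected_toListWalk v).1 h5⟩, rfl⟩

variable {S : Type*} [CommRing S] (f g : ℕ → S)

-- The weight depends only on the cycle types of the two ends, so the sum can be grouped by them.
open Classical in
theorem sum_weight_eq (s : Finset (ListWalk (Fin d))) :
    ∑ w ∈ s, weight f g w = ∑ α : d.Partition, ∑ β : d.Partition,
      (α.parts.map f).prod * (β.parts.map g).prod *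
        (#{w ∈ s | cyclePartition w.1 = α ∧ cyclePartition (w.1 * stepProd w.2) = β} : S) := by
  rw [← Fintype.sum_prod_type', ← sum_fiberwise (s := s)
    (g := fun w => (cyclePartition w.1, cyclePartition (w.1 * stepProd w.2)))]
  refine sum_congr rfl fun p _ => ?_
  rw [mul_comm, ← nsmul_eq_mul, ← sum_const]
  refine sum_congr (filter_congr fun w _ => Prod.ext_iff) fun w hw => ?_
  obtain ⟨-, h1, h2⟩ := mem_filter.1 hw
  rw [← h1, ← h2]
  rfl

theorem total_eq_sum (r : ℕ) : total f g (Fin d) r = ∑ α : d.Partition, ∑ β : d.Partition,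
    (α.parts.map f).prod * (β.parts.map g).prod * (walkCount r α β : S) := by
  simp_rw [walkCount_eq_card]
  exact sum_weight_eq f g _

theorem connTotal_eq_sum (r : ℕ) : connTotal f g (Fin d) r =
    ∑ α : d.Partition, ∑ β : d.Partition,
      (α.parts.map f).prod * (β.parts.map g).prod * (connectedWalkCount r α β : S) := by
  simp_rw [connectedWalkCount_eq_card]
  exact sum_weight_eq f g _

/-- This confines the connected series to the exponents indexed by the genus, so sorting by genus
loses no term. -/
theorem genus_of_connectedWalkCount_ne_zero (hd : d ≠ 0) {r : ℕ} {α β : d.Partition}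
    (h : connectedWalkCount r α β ≠ 0) : ∃ g : ℕ, r + 2 = 2 * g + (len α + len β) := by
  classical
  rw [connectedWalkCount_eq_card] at h
  obtain ⟨w, hw⟩ := card_ne_zero.1 h
  obtain ⟨hw, hα, hβ⟩ := mem_filter.1 hw
  obtain ⟨⟨hr, hm⟩, hc⟩ := mem_connected.1 hw
  have : NeZero d := ⟨hd⟩
  have hlen : ∀ σ : Perm (Fin d), len (cyclePartition σ) = Multiset.card σ.partition.parts :=
    fun _ => rfl
  rw [← hα, ← hβ, hlen, hlen, ← hr]
  exact exists_genus hc fun e he => (hm.1 e he).ne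

theorem len_pos (hd : d ≠ 0) (α : d.Partition) : 0 < len α := by
  rw [len, Multiset.card_pos]
  intro h
  have := α.parts_sum
  rw [h, Multiset.sum_zero] at this
  exact hd this.symm

end Counting

end MonotoneHurwitz

namespace MonotoneHurwitz

open Finset

/-! ### Logarithms of exponential generating series. -/

section Log

open PowerSeries

/-- A power series is the logarithm of `I` if it satisfies the differential equation
`I' = I L'`. -/
theorem logOf_eq_of_derivative {R : Type*} [CommRing R] [Algebra ℚ R]
    {I L : PowerSeries R} (hI : constantCoeff I = 1) (hL : constantCoeff L = 0)
    (h : derivative R I = I * derivative R L) : PowerSeries.logOf I = L := by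
  have : IsAddTorsionFree R := .of_module_rat R
  have hs : HasSubst (I - 1) := HasSubst.of_constantCoeff_zero' (by simp [hI])
  -- `PowerSeries.log` is the series of `log (1 + X)`. Substituting `I - 1` for `X` will turn this
  -- identity into `log'(I) · I = 1`.
  have hlog : derivative R (PowerSeries.log R) * (1 + X) = 1 := by
    rw [deriv_log]
    ext n
    rw [mul_add, mul_one, map_add]
    rcases n with _ | n
    · simp
    · rw [coeff_succ_mul_X, coeff_mk, coeff_mk, coeff_one, if_neg (by simp), ← map_add, pow_succ]
      simp
  have hD : (derivative R (PowerSeries.log R)).subst (I - 1) * I = 1 := by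
    have := congrArg (fun p => PowerSeries.subst (I - 1) p) hlog
    simp only [subst_mul hs, subst_add hs, subst_X hs] at this
    rw [← coe_substAlgHom hs, map_one, add_sub_cancel] at this
    rw [← coe_substAlgHom hs]
    exact this
  refine derivative.ext ?_ ?_
  · rw [logOf_eq, derivative_subst hs, map_sub, Derivation.map_one_eq_zero, sub_zero, h, ← mul_assoc, hD,
      one_mul]
  · rw [constantCoeff_logOf hI, hL]

/-- The exponential formula, for sequences related by the recursion on the component of a point.
The coefficients `q d` play the role of `1 / d!`. -/
theorem logOf_mk_eq {R : Type*} [CommRing R] [Algebra ℚ R] (q u v : ℕ → R) (hq0 : q 0 = 1)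
    (hq : ∀ n : ℕ, q (n + 1) * ((n : R) + 1) = q n) (hu : u 0 = 1) (hv : v 0 = 0)
    (h : ∀ n, u (n + 1) = ∑ k ∈ range (n + 1), n.choose k • (v (k + 1) * u (n - k))) :
    PowerSeries.logOf (PowerSeries.mk fun d => q d * u d) =
      PowerSeries.mk fun d => q d * v d := by
  have hfac : ∀ n : ℕ, q n * (n.factorial : R) = 1 := by
    intro n
    induction n with
    | zero => simp [hq0]
    | succ n ih => rw [← ih, ← hq n, Nat.factorial_succ]; push_cast; ring
  have hchoose : ∀ n k : ℕ, k ≤ n → q n * (n.choose k : R) = q k * q (n - k) := by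
    intro n k hk
    have hn := hfac n
    rw [← Nat.choose_mul_factorial_mul_factorial hk] at hn
    push_cast at hn
    calc q n * (n.choose k : R)
        = q n * n.choose k * (q k * k.factorial) * (q (n - k) * (n - k).factorial) := by
          rw [hfac, hfac, mul_one, mul_one]
      _ = q n * (n.choose k * k.factorial * (n - k).factorial) * (q k * q (n - k)) := by ring
      _ = q k * q (n - k) := by rw [hn, one_mul]
  refine logOf_eq_of_derivative (by simp [← coeff_zero_eq_constantCoeff_apply, hu, hq0])
    (by simp [← coeff_zero_eq_constantCoeff_apply, hv]) ?_
  -- The coefficient of `z^n` in `I' = I L'` is the recursion `h` times `q n`, because `q n *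
  -- n.choose k = q k * q (n - k)`.
  ext n
  rw [coeff_derivative, coeff_mk, mul_right_comm, hq, mul_comm _ (derivative R _), coeff_mul, h,
    Nat.sum_antidiagonal_eq_sum_range_succ_mk, mul_sum]
  refine sum_congr rfl fun k hk => ?_
  have hk : k ≤ n := Nat.lt_succ_iff.1 (mem_range.1 hk)
  rw [coeff_derivative, coeff_mk, coeff_mk, mul_right_comm (q (k + 1)), hq, nsmul_eq_mul,
    ← mul_assoc, hchoose n k hk]
  ring

end Log

/-! ### Formal sums of Laurent series. -/

section FormalSum

variable {S : Type*} [CommRing S]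

/-- The family `s` of Laurent series is formally summable with sum `x`. -/
def IsFormalSum (s : ℕ → LaurentSeries S) (x : LaurentSeries S) : Prop :=
  ∃ t : HahnSeries.SummableFamily ℤ S ℕ, (∀ g, t g = s g) ∧ t.hsum = x

theorem IsFormalSum.zero : IsFormalSum (fun _ => (0 : LaurentSeries S)) 0 :=
  ⟨0, fun _ => rfl, HahnSeries.SummableFamily.hsum_zero⟩

theorem IsFormalSum.add {s s' : ℕ → LaurentSeries S} {x x' : LaurentSeries S}
    (h : IsFormalSum s x) (h' : IsFormalSum s' x') :
    IsFormalSum (fun g => s g + s' g) (x + x') := by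
  obtain ⟨t, ht, rfl⟩ := h
  obtain ⟨t', ht', rfl⟩ := h'
  exact ⟨t + t', fun g => by rw [HahnSeries.SummableFamily.add_apply, ht, ht'],
    HahnSeries.SummableFamily.hsum_add⟩

theorem IsFormalSum.sum {ι : Type*} (A : Finset ι) {s : ι → ℕ → LaurentSeries S}
    {x : ι → LaurentSeries S} (h : ∀ i ∈ A, IsFormalSum (s i) (x i)) :
    IsFormalSum (fun g => ∑ i ∈ A, s i g) (∑ i ∈ A, x i) := by
  classical
  induction A using Finset.induction_on with
  | empty => simpa using IsFormalSum.zero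
  | insert a A ha ih =>
    simp only [sum_insert ha]
    exact (h a (mem_insert_self _ _)).add (ih fun i hi => h i (mem_insert_of_mem hi))

theorem IsFormalSum.const_mul (a : S) {s : ℕ → LaurentSeries S} {x : LaurentSeries S}
    (h : IsFormalSum s x) :
    IsFormalSum (fun g => HahnSeries.single 0 a * s g) (HahnSeries.single 0 a * x) := by
  have hC : ∀ y : LaurentSeries S, HahnSeries.single 0 a * y = a • y := fun y => by
    ext n
    rw [HahnSeries.coeff_single_zero_mul, HahnSeries.coeff_smul, smul_eq_mul]
  obtain ⟨t, ht, rfl⟩ := h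
  refine ⟨a • t, fun g => by simp only [HahnSeries.SummableFamily.smul_apply', ht, hC], ?_⟩
  rw [hC]
  ext n
  simp only [HahnSeries.SummableFamily.coeff_hsum, HahnSeries.SummableFamily.smul_apply',
    HahnSeries.coeff_smul]
  exact (smul_finsum' a (t.finite_co_support n)).symm

/-- A Laurent series with exponents in `b + a + 2ℕ` is the formal sum of its terms. -/
theorem isFormalSum_single (a : ℕ) (b : ℤ) (y : ℕ → S) (hy : ∀ r, y r ≠ 0 → ∃ g, r = 2 * g + a) :
    IsFormalSum (fun g => HahnSeries.single (2 * (g : ℤ) + a + b) (y (2 * g + a)))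
      (HahnSeries.single b 1 * HahnSeries.ofPowerSeries ℤ S (PowerSeries.mk y)) := by
  have hc : ∀ (g : ℕ) (n : ℤ), (HahnSeries.single (2 * (g : ℤ) + a + b) (y (2 * g + a))).coeff n ≠ 0
      → n = 2 * (g : ℤ) + a + b := by
    intro g n h
    by_contra hne
    exact h (HahnSeries.coeff_single_of_ne hne)
  -- All exponents are at least `b`, and distinct `g` give distinct exponents, so each coefficient
  -- receives at most one term.
  refine ⟨⟨_, ?_, ?_⟩, fun g => rfl, ?_⟩
  · refine Set.IsWF.isPWO ?_
    refine BddBelow.isWF ⟨b, ?_⟩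
    rintro n hn
    obtain ⟨g, hg⟩ := Set.mem_iUnion.1 hn
    have := hc g n hg
    omega
  · intro n
    refine Set.Subsingleton.finite ?_
    intro g hg g' hg'
    have h1 := hc g n hg
    have h2 := hc g' n hg'
    omega
  · ext n
    rw [HahnSeries.SummableFamily.coeff_hsum]
    have hR : (HahnSeries.single b (1 : S) *
        HahnSeries.ofPowerSeries ℤ S (PowerSeries.mk y)).coeff n =
          (HahnSeries.ofPowerSeries ℤ S (PowerSeries.mk y)).coeff (n - b) := by
      have := HahnSeries.coeff_single_mul_add (r := (1 : S))
        (x := HahnSeries.ofPowerSeries ℤ S (PowerSeries.mk y)) (a := n - b) (b := b)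
      rwa [sub_add_cancel, one_mul] at this
    rw [hR]
    by_cases hn : ∃ g : ℕ, n = 2 * (g : ℤ) + a + b
    · obtain ⟨g, rfl⟩ := hn
      rw [finsum_eq_single _ g]
      · rw [show 2 * (g : ℤ) + a + b - b = ((2 * g + a : ℕ) : ℤ) by push_cast; ring,
          HahnSeries.ofPowerSeries_apply_coeff, PowerSeries.coeff_mk]
        exact HahnSeries.coeff_single_same _ _
      · intro g' hg'
        by_contra hne
        have := hc g' _ hne
        omega
    · rw [finsum_eq_zero_of_forall_eq_zero]
      · by_cases hnb : 0 ≤ n - b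
        · obtain ⟨r, hr⟩ := Int.eq_ofNat_of_zero_le hnb
          rw [hr, HahnSeries.ofPowerSeries_apply_coeff, PowerSeries.coeff_mk]
          by_contra hne
          obtain ⟨g, rfl⟩ := hy r (Ne.symm hne)
          exact hn ⟨g, by push_cast at hr; omega⟩
        · symm
          rw [HahnSeries.ofPowerSeries_apply]
          refine HahnSeries.embDomain_of_notMem_range ?_
          rintro ⟨r, hr⟩
          apply hnb
          rw [← hr]
          simp
      · intro g
        by_contra hne
        exact hn ⟨g, hc g n hne⟩

end FormalSum

end MonotoneHurwitz

namespace MonotoneHurwitz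

open Finset

/-! ### Generating series in `ħ`. -/

section Series

variable {S : Type*} [CommRing S] (f g : ℕ → S)

/-- The generating series of monotone walks of degree `d` in the variable `-ħ`. -/
noncomputable def totalSeries (d : ℕ) : PowerSeries S :=
  PowerSeries.mk fun r => (-1) ^ r * total f g (Fin d) r

/-- The generating series of connected monotone walks of degree `d ≥ 1` in the variable `-ħ`. -/
noncomputable def connSeries (d : ℕ) : PowerSeries S :=
  -- On no points every walk is vacuously connected, yet a logarithm has constant term `0`.
  if d = 0 then 0 else PowerSeries.mk fun r => (-1) ^ r * connTotal f g (Fin d) r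

theorem totalSeries_zero : totalSeries f g 0 = 1 := by
  ext r
  rw [totalSeries, PowerSeries.coeff_mk, total_zero, PowerSeries.coeff_one]
  split_ifs with h
  · simp [h]
  · simp

theorem totalSeries_succ (n : ℕ) : totalSeries f g (n + 1) =
    ∑ k ∈ range (n + 1), n.choose k • (connSeries f g (k + 1) * totalSeries f g (n - k)) := by
  ext r
  rw [totalSeries, PowerSeries.coeff_mk, total_succ, mul_sum, map_sum]
  refine sum_congr rfl fun k _ => ?_
  rw [map_nsmul, PowerSeries.coeff_mul, mul_smul_comm, mul_sum]
  congr 1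
  refine sum_congr rfl fun p hp => ?_
  rw [← HasAntidiagonal.mem_antidiagonal.1 hp, connSeries, if_neg (Nat.succ_ne_zero k), totalSeries,
    PowerSeries.coeff_mk, PowerSeries.coeff_mk, pow_add]
  ring

end Series

/-! ### The genus expansion for multiplicative weights. -/

section Expansion

variable {K : Type*} [Field K] (f g : ℕ → Coef K)

theorem hbar_zero_mul (x : Coef K) (p : PowerSeries (Coef K)) :
    hbar 0 x * HahnSeries.ofPowerSeries ℤ (Coef K) p =
      HahnSeries.ofPowerSeries ℤ (Coef K) (PowerSeries.C x * p) := by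
  rw [map_mul, HahnSeries.ofPowerSeries_C]
  rfl

theorem smul_eq_hbar_zero_mul (a : K) (x : LaurentSeries (Coef K)) :
    a • x = hbar 0 (MvPowerSeries.C a) * x := by
  refine HahnSeries.ext (funext fun n => ?_)
  rw [hbar, HahnSeries.coeff_single_zero_mul, HahnSeries.coeff_smul,
    MvPowerSeries.smul_eq_C_mul]

theorem hbar_mul_hbar (m n : ℤ) (x y : Coef K) : hbar m x * hbar n y = hbar (m + n) (x * y) :=
  HahnSeries.single_mul_single

theorem ofPowerSeries_totalSeries (d : ℕ) :
    HahnSeries.ofPowerSeries ℤ (Coef K) (totalSeries f g d) =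
      ∑ α : d.Partition, ∑ β : d.Partition,
        hbar 0 ((α.parts.map f).prod * (β.parts.map g).prod) * walkSeries K α β := by
  simp only [walkSeries, hbar_zero_mul, ← map_sum]
  congr 1
  ext r : 1
  simp only [totalSeries, PowerSeries.coeff_mk, total_eq_sum, map_sum, PowerSeries.coeff_C_mul,
    mul_sum]
  exact sum_congr rfl fun α _ => sum_congr rfl fun β _ => by ring

/-- The connected generating series is a sum over the genus. -/
theorem isFormalSum_connSeries (c : ℕ) {d : ℕ} (hd : d ≠ 0) :
    IsFormalSum (fun n => ∑ α : d.Partition, ∑ β : d.Partition,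
        hbar (2 * (n : ℤ) - 2 + (len α + len β) - c * d)
          ((α.parts.map f).prod * (β.parts.map g).prod * (-1) ^ (len α + len β) *
            (doubleHurwitz n α β : Coef K)))
      (hbar (-(c * d)) 1 * HahnSeries.ofPowerSeries ℤ (Coef K) (connSeries f g d)) := by
  have h : hbar (-(c * d)) 1 * HahnSeries.ofPowerSeries ℤ (Coef K) (connSeries f g d) =
      ∑ α : d.Partition, ∑ β : d.Partition, HahnSeries.single (-(c * d : ℤ)) 1 *
        HahnSeries.ofPowerSeries ℤ (Coef K) (PowerSeries.mk fun r => (-1) ^ r *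
          ((α.parts.map f).prod * (β.parts.map g).prod * (connectedWalkCount r α β : Coef K))) := by
    simp only [← mul_sum, ← map_sum, hbar]
    congr 2
    ext r : 1
    simp only [connSeries, if_neg hd, PowerSeries.coeff_mk, connTotal_eq_sum, map_sum, mul_sum]
  rw [h]
  refine IsFormalSum.sum _ fun α _ => IsFormalSum.sum _ fun β _ => ?_
  -- Positive lengths give `len α + len β ≥ 2`, so the natural subtraction of `2` is exact.
  have hα := len_pos hd α
  have hβ := len_pos hd β
  have hs := isFormalSum_single (len α + len β - 2) (-(c * d : ℤ)) (fun r => (-1) ^ r *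
    ((α.parts.map f).prod * (β.parts.map g).prod * (connectedWalkCount r α β : Coef K))) (by
      intro r hr
      obtain ⟨n, hn⟩ := genus_of_connectedWalkCount_ne_zero hd (r := r) (α := α) (β := β) (by
        intro h0
        simp [h0] at hr)
      exact ⟨n, by omega⟩)
  convert hs using 2 with n
  rw [hbar]
  have he : 2 * (n : ℤ) - 2 + (len α + len β) - c * d =
      2 * (n : ℤ) + ((len α + len β - 2 : ℕ) : ℤ) + -(c * d) := by
    rw [Nat.cast_sub (by omega)]; push_cast; ring
  have hr : 2 * n + len α + len β - 2 = 2 * n + (len α + len β - 2) := by omega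
  have hsign : (-1 : Coef K) ^ (2 * n + (len α + len β - 2)) = (-1) ^ (len α + len β) := by
    obtain ⟨m, hm⟩ := Nat.exists_eq_add_of_le (show 2 ≤ len α + len β by omega)
    rw [hm, Nat.add_sub_cancel_left, pow_add, pow_mul, pow_add]
    simp
  rw [he, doubleHurwitz, hr, hsign]
  congr 1
  ring

variable [CharZero K]

/-- The logarithm of a partition function of monotone walks with multiplicative weights has a
topological expansion. -/
theorem hasTopologicalExpansion_logOf (c : ℕ) :
    HasTopologicalExpansion
      (PowerSeries.logOf (couplingSeries (K := K) 1 fun d => hbar (-(c * d)) 1 *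
        ∑ α : d.Partition, ∑ β : d.Partition,
          hbar 0 ((α.parts.map f).prod * (β.parts.map g).prod) * walkSeries K α β))
      (fun n => couplingSeries (K := K) 0 fun d => ∑ α : d.Partition, ∑ β : d.Partition,
        hbar ((len α + len β) - c * d)
          ((α.parts.map f).prod * (β.parts.map g).prod * (-1) ^ (len α + len β) *
            (doubleHurwitz n α β : Coef K))) := by
  let u : ℕ → LaurentSeries (Coef K) := fun d =>
    hbar (-(c * d)) 1 * HahnSeries.ofPowerSeries ℤ (Coef K) (totalSeries f g d)
  let v : ℕ → LaurentSeries (Coef K) := fun d =>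
    hbar (-(c * d)) 1 * HahnSeries.ofPowerSeries ℤ (Coef K) (connSeries f g d)
  have hu : u 0 = 1 := by
    simp only [u, totalSeries_zero, map_one, mul_one]
    simp [hbar]
  have hv : v 0 = 0 := by simp [v, connSeries]
  have hrec : ∀ n, u (n + 1) = ∑ k ∈ range (n + 1), n.choose k • (v (k + 1) * u (n - k)) := by
    intro n
    simp only [u, totalSeries_succ, map_sum, mul_sum]
    refine sum_congr rfl fun k hk => ?_
    have hk : k ≤ n := Nat.lt_succ_iff.1 (mem_range.1 hk)
    rw [map_nsmul, mul_smul_comm, map_mul]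
    congr 1
    simp only [v]
    -- The factor `ħ^(-cd)` is multiplicative in `d`, and `(k + 1) + (n - k) = n + 1`, so the
    -- recursion survives the rescaling.
    rw [mul_mul_mul_comm, hbar_mul_hbar, mul_one]
    congr 2
    push_cast [hk]
    ring
  let q : ℕ → LaurentSeries (Coef K) := fun d => hbar 0 (MvPowerSeries.C (d.factorial : K)⁻¹)
  have hq0 : q 0 = 1 := by
    simp only [q, Nat.factorial_zero, Nat.cast_one, inv_one, map_one]
    rfl
  have hq : ∀ n : ℕ, q (n + 1) * ((n : LaurentSeries (Coef K)) + 1) = q n := by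
    intro n
    have h1 : ((n : LaurentSeries (Coef K)) + 1) = hbar 0 (MvPowerSeries.C ((n : K) + 1)) := by
      rw [map_add, map_one, map_natCast, hbar, HahnSeries.single_add]
      refine congrArg (· + 1) ?_
      exact (map_natCast (HahnSeries.C : Coef K →+* LaurentSeries (Coef K)) n).symm
    simp only [q]
    rw [h1, hbar_mul_hbar, add_zero, ← map_mul, Nat.factorial_succ]
    congr 2
    have h2 : (n.factorial : K) ≠ 0 := Nat.cast_ne_zero.2 n.factorial_ne_zero
    have h3 : (n : K) + 1 ≠ 0 := Nat.cast_add_one_ne_zero n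
    push_cast
    field_simp
  have hI : (couplingSeries (K := K) 1 fun d => hbar (-(c * d)) 1 *
        ∑ α : d.Partition, ∑ β : d.Partition,
          hbar 0 ((α.parts.map f).prod * (β.parts.map g).prod) * walkSeries K α β) =
      PowerSeries.mk fun d => q d * u d := by
    ext d : 1
    rw [couplingSeries, PowerSeries.coeff_mk, PowerSeries.coeff_mk]
    split_ifs with hd
    · rw [hd, hu, hq0, mul_one]
    · rw [← ofPowerSeries_totalSeries, smul_eq_hbar_zero_mul]
  rw [hI, logOf_mk_eq q u v hq0 hq hu hv hrec]
  intro d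
  change IsFormalSum _ _
  simp only [PowerSeries.coeff_C_mul, couplingSeries, PowerSeries.coeff_mk]
  by_cases hd : d = 0
  · subst hd
    simpa [hv] using IsFormalSum.zero
  · simp only [if_neg hd, smul_eq_hbar_zero_mul]
    have h := (isFormalSum_connSeries f g c hd).const_mul (MvPowerSeries.C (d.factorial : K)⁻¹)
    refine cast (congrArg (IsFormalSum · _) (funext fun n => Eq.symm ?_)) h
    rw [mul_left_comm]
    refine congrArg (hbar 0 _ * ·) ?_
    rw [mul_sum]
    refine sum_congr rfl fun α _ => ?_
    rw [mul_sum]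
    refine sum_congr rfl fun β _ => ?_
    rw [hbar_mul_hbar, one_mul, ← add_sub_assoc]

/-! ### Specialisation to double, single and simple Hurwitz numbers. -/

/-- The weight that selects parts equal to `1`. -/
noncomputable def onesWeight (K : Type*) [Field K] (k : ℕ) : Coef K := if k = 1 then 1 else 0

theorem eq_ones_iff {d : ℕ} (α : d.Partition) : α = ones d ↔ ∀ k ∈ α.parts, k = 1 := by
  constructor
  · rintro rfl k hk
    exact Multiset.eq_of_mem_replicate hk
  · intro h
    have h1 := Multiset.eq_replicate_card.2 h
    have h2 : Multiset.card α.parts = d := by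
      have := α.parts_sum
      rw [h1] at this
      simpa using this
    exact Nat.Partition.ext (by rw [h1, h2]; rfl)

-- The product of the weights over the parts is the indicator of `1^d`, which restricts an end of
-- the walk to the identity.
omit [CharZero K] in
theorem sum_onesWeight {M : Type*} [AddCommMonoid M] {d : ℕ} (F : d.Partition → Coef K → M)
    (hF : ∀ β, F β 0 = 0) :
    ∑ β : d.Partition, F β (β.parts.map (onesWeight K)).prod = F (ones d) 1 := by
  rw [Fintype.sum_eq_single (ones d)]
  · congr 1
    refine Multiset.prod_eq_one fun x hx => ?_
    obtain ⟨k, hk, rfl⟩ := Multiset.mem_map.1 hx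
    rw [onesWeight, if_pos ((eq_ones_iff _).1 rfl k hk)]
  · intro β hβ
    rw [Ne, eq_ones_iff] at hβ
    push Not at hβ
    obtain ⟨k, hk, hk1⟩ := hβ
    rw [Multiset.prod_eq_zero (Multiset.mem_map.2 ⟨k, hk, by rw [onesWeight, if_neg hk1]⟩), hF]

theorem len_ones (d : ℕ) : len (ones d) = d := Multiset.card_replicate d 1

omit [CharZero K] in
theorem hbar_zero_right (n : ℤ) : hbar n (0 : Coef K) = 0 := HahnSeries.single_eq_zero

theorem hasTopologicalExpansion_partitionFunction2 :
    HasTopologicalExpansion (PowerSeries.logOf (partitionFunction2 K)) (freeEnergy2 K) := by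
  convert hasTopologicalExpansion_logOf (powerSum K Sum.inl) (powerSum K Sum.inr) 0 using 1
  · refine congrArg PowerSeries.logOf ?_
    rw [partitionFunction2]
    refine congrArg (couplingSeries _) (funext fun d => ?_)
    rw [Nat.cast_zero, zero_mul, neg_zero, show hbar 0 (1 : Coef K) = 1 from rfl, one_mul]
    rfl
  · ext1 n
    rw [freeEnergy2]
    refine congrArg (couplingSeries _) (funext fun d => ?_)
    rw [Nat.cast_zero, zero_mul]
    simp only [sub_zero]
    rfl

/-- With `c = 1`, the `ħ^d` coming from `ℓ(1^d) = d` cancels against `ħ^(-d)`, but the sign `(-1)^d`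
remains. -/
theorem hasTopologicalExpansion_partitionFunction1 :
    HasTopologicalExpansion (PowerSeries.logOf (partitionFunction1 K)) (freeEnergy1 K) := by
  convert hasTopologicalExpansion_logOf (powerSum K Sum.inl) (onesWeight K) 1 using 1
  · refine congrArg PowerSeries.logOf ?_
    rw [partitionFunction1]
    refine congrArg (couplingSeries _) (funext fun d => ?_)
    rw [mul_sum]
    refine sum_congr rfl fun α _ => ?_
    rw [sum_onesWeight (K := K) (fun β x => hbar 0 ((α.parts.map (powerSum K Sum.inl)).prod * x) *
      walkSeries K α β) fun β => by rw [mul_zero, hbar_zero_right, zero_mul], ← mul_assoc,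
      hbar_mul_hbar, mul_one, one_mul, add_zero, Nat.cast_one, one_mul]
    rfl
  · ext1 n
    rw [freeEnergy1]
    refine congrArg (couplingSeries _) (funext fun d => ?_)
    refine sum_congr rfl fun α _ => ?_
    rw [sum_onesWeight (K := K) (fun β x => hbar (K := K) ((len α + len β) - (1 : ℕ) * d)
      ((α.parts.map (powerSum K Sum.inl)).prod * x * (-1) ^ (len α + len β) *
        (doubleHurwitz n α β : Coef K)))
      fun β => by rw [mul_zero, zero_mul, zero_mul, hbar_zero_right], mul_one, len_ones,
      Nat.cast_one, one_mul, add_sub_cancel_right]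
    rfl

/-- With `c = 2`, both ends are `1^d`: the `ħ^(2d)` cancels and the sign `(-1)^(2d)` is trivial. -/
theorem hasTopologicalExpansion_partitionFunction0 :
    HasTopologicalExpansion (PowerSeries.logOf (partitionFunction0 K)) (freeEnergy0 K) := by
  convert hasTopologicalExpansion_logOf (onesWeight K) (onesWeight K) 2 using 1
  · refine congrArg PowerSeries.logOf ?_
    rw [partitionFunction0]
    refine congrArg (couplingSeries _) (funext fun d => ?_)
    rw [sum_onesWeight (K := K) (fun α x => ∑ β : d.Partition,
      hbar 0 (x * (β.parts.map (onesWeight K)).prod) * walkSeries K α β)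
      fun α => by simp only [zero_mul, hbar_zero_right, sum_const_zero],
      sum_onesWeight (K := K) (fun β x => hbar 0 (1 * x) * walkSeries K (ones d) β)
      fun β => by rw [mul_zero, hbar_zero_right, zero_mul], mul_one,
      show hbar 0 (1 : Coef K) = 1 from rfl, one_mul]
    rfl
  · ext1 n
    rw [freeEnergy0]
    refine congrArg (couplingSeries _) (funext fun d => ?_)
    rw [sum_onesWeight (K := K) (fun α x => ∑ β : d.Partition, hbar (K := K) ((len α + len β) - (2 : ℕ) * d)
      (x * (β.parts.map (onesWeight K)).prod * (-1) ^ (len α + len β) *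
        (doubleHurwitz n α β : Coef K)))
      fun α => by simp only [zero_mul, hbar_zero_right, sum_const_zero],
      sum_onesWeight (K := K) (fun β x => hbar (K := K) ((len (ones d) + len β) - (2 : ℕ) * d)
      (1 * x * (-1) ^ (len (ones d) + len β) * (doubleHurwitz n (ones d) β : Coef K)))
      fun β => by rw [mul_zero, zero_mul, zero_mul, hbar_zero_right], mul_one, len_ones,
      Even.neg_one_pow ⟨d, rfl⟩, one_mul, one_mul,
      show (d : ℤ) + d - (2 : ℕ) * d = 0 by push_cast; ring]
    rfl

end Expansion

end MonotoneHurwitz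

theorem mainTheorem6 (K : Type*) [Field K] [CharZero K] :
    MonotoneHurwitz.HasTopologicalExpansion
        (PowerSeries.logOf (MonotoneHurwitz.partitionFunction0 K))
        (MonotoneHurwitz.freeEnergy0 K) ∧
      MonotoneHurwitz.HasTopologicalExpansion
        (PowerSeries.logOf (MonotoneHurwitz.partitionFunction1 K))
        (MonotoneHurwitz.freeEnergy1 K) ∧
      MonotoneHurwitz.HasTopologicalExpansion
        (PowerSeries.logOf (MonotoneHurwitz.partitionFunction2 K))
        (MonotoneHurwitz.freeEnergy2 K) := by
  exact ⟨MonotoneHurwitz.hasTopologicalExpansion_partitionFunction0,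
    MonotoneHurwitz.hasTopologicalExpansion_partitionFunction1,
    MonotoneHurwitz.hasTopologicalExpansion_partitionFunction2⟩
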